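/- All algebras are associative unital $\mathbb C$-algebras and $[a,b]_{\mathscr L}=ab-ba$. Let $n\ge 0$ be an integer. * $\mathcal C(m)$ is the Clifford algebra with generators $\omega_1,\dots,\omega_m$ and relations $\omega_j\omega_k+\omega_k\omega_j=2\delta_{jk}$, which is $\mathbb Z_2$-graded with all $\omega_j$ odd ($\mathcal C(0)=\mathbb C$). * $\mathcal A_\Lambda(n)$ is the algebra with generators $\omega_1,\dots,\omega_{2n+1},E_+,E_-,\Lambda$ and relations: $\Lambda$ is central, $[E_+,E_-]_{\mathscr L}=-\tfrac14+i^n\Lambda\,\omega_1\cdots\omega_{2n+1}$, $\omega_j\omega_k+\omega_k\omega_j=2\delta_{jk}$, and $E_\pm\omega_j=-\omega_jE_\pm$ for all $1\le j,k\le 2n+1$. * $\mathfrak{osp}(1,2)$ is the complex Lie superalgebra with even part $\operatorname{span}\{Y,F,G\}$, odd part $\operatorname{span}\{E_+,E_-\}$ and superbrackets $[Y,E_\pm]=\pm\tfrac12E_\pm$, $[Y,F]=F$, $[Y,G]=-G$, $[F,G]=2Y$, $[F,E_+]=[G,E_-]=0$, $[F,E_-]=-E_+$, $[G,E_+]=-E_-$,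 $[E_+,E_+]=F$, $[E_-,E_-]=-G$, $[E_+,E_-]=Y$. Its enveloping algebra $\mathcal U$ is $\mathbb Z_2$-graded by parity, and the ghost is $\theta=\tfrac14+[E_+,E_-]_{\mathscr L}\in\mathcal U$. * $\otimes_{\mathbb Z_2}$ is the graded tensor product, $(a\otimes u)(a'\otimes u')=(-1)^{\deg u\,\deg a'}aa'\otimes uu'$ for homogeneous elements, and $\otimes$ is the ordinary tensor product of algebras over $\mathbb C$. * $\mathfrak S_2\ltimes\mathcal U$ is the smash product: the space $\mathcal U\otimes\mathbb C[\mathfrak S_2]$ with product $(u\otimes g)(u'\otimes g')=u(g\cdot u')\otimes gg'$, where the non-trivial element of $\mathfrak S_2$ acts on $\mathcal U$ by the parity automorphism. * $\mathcal M_r(A)$ is the algebra of $r\times r$ matrices with entries in $A$. **Proposition 7.4.** 1. There is an algebra isomorphism $\mathcal A_\Lambda(n)\simeq\mathcal C(2n+1)\otimes_{\mathbb Z_2}\mathcal U$ that sends $\omega_j$ to $\omega_j\otimes 1$, $E_\pm$ to $1\otimes E_\pm$ and $\Lambda$ to $i^n\omega_1\cdots\omega_{2n+1}\otimes\theta$,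 and the latter element is central in $\mathcal C(2n+1)\otimes_{\mathbb Z_2}\mathcal U$. 2. There are algebra isomorphisms $\mathcal A_\Lambda(n)\simeq\mathcal C(2n)\otimes(\mathfrak S_2\ltimes\mathcal U)\simeq\mathcal M_{2^n}(\mathfrak S_2\ltimes\mathcal U)$. -/

import Mathlib

open scoped TensorProduct

/-! ### Lie superalgebras over `ℂ` and their enveloping algebras -/

theorem zmodTwo_cases (i : ZMod 2) : i = 0 ∨ i = 1 := by
  revert i
  decide

/-- A `ZMod 2`-grading given by a projection `p` onto the even part along the odd part. -/
@[reducible]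
noncomputable def superDecomposition {M : Type*} [AddCommGroup M] [Module ℂ M]
    (𝒢 : ZMod 2 → Submodule ℂ M) (p : M →ₗ[ℂ] M)
    (h0 : ∀ x, p x ∈ 𝒢 0) (h1 : ∀ x, x - p x ∈ 𝒢 1)
    (he : ∀ x ∈ 𝒢 0, p x = x) (ho : ∀ x ∈ 𝒢 1, p x = 0) : DirectSum.Decomposition 𝒢 :=
  DirectSum.Decomposition.ofLinearMap 𝒢
    (DirectSum.lof ℂ (ZMod 2) (fun i => 𝒢 i) 0 ∘ₗ p.codRestrict (𝒢 0) h0 +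
      DirectSum.lof ℂ (ZMod 2) (fun i => 𝒢 i) 1 ∘ₗ
        (LinearMap.id - p).codRestrict (𝒢 1) h1)
    (by
      ext x
      simp)
    (by
      ext i x : 2
      obtain ⟨x, hx⟩ := x
      have hi := zmodTwo_cases i
      rcases hi with rfl | rfl
      · have e1 : p.codRestrict (𝒢 0) h0 x = ⟨x, hx⟩ := Subtype.ext (he x hx)
        have e2 : (LinearMap.id - p).codRestrict (𝒢 1) h1 x = 0 :=
          Subtype.ext (by simp [he x hx])
        simp [e1, e2]
      · have e1 : p.codRestrict (𝒢 0) h0 x = 0 := Subtype.ext (ho x hx)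
        have e2 : (LinearMap.id - p).codRestrict (𝒢 1) h1 x = ⟨x, hx⟩ :=
          Subtype.ext (by simp [ho x hx])
        simp [e1, e2])

/-- The sign `(-1)^(ij)` attached to two parities. -/
def superSign (i j : ZMod 2) : ℂ := (-1) ^ (i.val * j.val)

/-- A (complex) Lie superalgebra structure on a `ZMod 2`-graded vector space `L = L₀ ⊕ L₁`:
an even bilinear bracket that is super-antisymmetric and satisfies the super Jacobi identity. -/
structure LieSuperalgebra {L : Type*} [AddCommGroup L] [Module ℂ L]
    (𝒢 : ZMod 2 → Submodule ℂ L) [DirectSum.Decomposition 𝒢] where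
  bracket : L →ₗ[ℂ] L →ₗ[ℂ] L
  bracket_mem : ∀ {i j : ZMod 2} {x y : L}, x ∈ 𝒢 i → y ∈ 𝒢 j → bracket x y ∈ 𝒢 (i + j)
  skew : ∀ {i j : ZMod 2} {x y : L}, x ∈ 𝒢 i → y ∈ 𝒢 j →
    bracket x y = -(superSign i j • bracket y x)
  jacobi : ∀ {i j k : ZMod 2} {x y z : L}, x ∈ 𝒢 i → y ∈ 𝒢 j → z ∈ 𝒢 k →
    bracket x (bracket y z) =
      bracket (bracket x y) z + superSign i j • bracket y (bracket x z)

/-- The parity operator `x₀ + x₁ ↦ x₀ - x₁` of a `ZMod 2`-graded vector space. -/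
noncomputable def parityMap {L : Type*} [AddCommGroup L] [Module ℂ L]
    (𝒢 : ZMod 2 → Submodule ℂ L) [DirectSum.Decomposition 𝒢] : L →ₗ[ℂ] L :=
  ((𝒢 0).subtype ∘ₗ DirectSum.component ℂ (ZMod 2) (fun i => 𝒢 i) 0 -
    (𝒢 1).subtype ∘ₗ DirectSum.component ℂ (ZMod 2) (fun i => 𝒢 i) 1) ∘ₗ
      (DirectSum.decomposeLinearEquiv 𝒢).toLinearMap

theorem parityMap_of_mem {L : Type*} [AddCommGroup L] [Module ℂ L]
    (𝒢 : ZMod 2 → Submodule ℂ L) [DirectSum.Decomposition 𝒢] {i : ZMod 2} {x : L}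
    (hx : x ∈ 𝒢 i) : parityMap 𝒢 x = (-1 : ℂ) ^ i.val • x := by
  have hi := zmodTwo_cases i
  change (DirectSum.decompose 𝒢 x 0 : L) - (DirectSum.decompose 𝒢 x 1 : L) = _
  rcases hi with rfl | rfl
  · rw [DirectSum.decompose_of_mem_same 𝒢 hx, DirectSum.decompose_of_mem_ne 𝒢 hx (by decide)]
    simp
  · rw [DirectSum.decompose_of_mem_same 𝒢 hx, DirectSum.decompose_of_mem_ne 𝒢 hx (by decide)]
    simp [ZMod.val_one]

theorem superDecomposition_ext {L V : Type*} [AddCommGroup L] [Module ℂ L] [AddCommGroup V]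
    [Module ℂ V] (𝒢 : ZMod 2 → Submodule ℂ L) [DirectSum.Decomposition 𝒢] {f g : L →ₗ[ℂ] V}
    (h : ∀ (i : ZMod 2) (x : L), x ∈ 𝒢 i → f x = g x) : f = g :=
  DirectSum.decompose_lhom_ext 𝒢 fun i => LinearMap.ext fun x => h i x x.2

namespace LieSuperalgebra

/-- The relations `x y - (-1)^(ij) y x = [x, y]` (`x`, `y` homogeneous of parities `i`, `j`)
of the enveloping algebra. -/
inductive EnvelopingRel {L : Type*} [AddCommGroup L] [Module ℂ L]
    {𝒢 : ZMod 2 → Submodule ℂ L} [DirectSum.Decomposition 𝒢] (𝔤 : LieSuperalgebra 𝒢) :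
    TensorAlgebra ℂ L → TensorAlgebra ℂ L → Prop
  | superComm {i j : ZMod 2} {x y : L} (hx : x ∈ 𝒢 i) (hy : y ∈ 𝒢 j) :
      EnvelopingRel 𝔤
        (TensorAlgebra.ι ℂ x * TensorAlgebra.ι ℂ y -
          superSign i j • (TensorAlgebra.ι ℂ y * TensorAlgebra.ι ℂ x))
        (TensorAlgebra.ι ℂ (𝔤.bracket x y))

/-- The enveloping algebra of a Lie superalgebra. -/
def Enveloping {L : Type*} [AddCommGroup L] [Module ℂ L]
    {𝒢 : ZMod 2 → Submodule ℂ L} [DirectSum.Decomposition 𝒢] (𝔤 : LieSuperalgebra 𝒢) :=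
  RingQuot (EnvelopingRel 𝔤)

namespace Enveloping

noncomputable instance {L : Type*} [AddCommGroup L] [Module ℂ L]
    {𝒢 : ZMod 2 → Submodule ℂ L} [DirectSum.Decomposition 𝒢] (𝔤 : LieSuperalgebra 𝒢) :
    Ring 𝔤.Enveloping :=
  inferInstanceAs (Ring (RingQuot (EnvelopingRel 𝔤)))

noncomputable instance {L : Type*} [AddCommGroup L] [Module ℂ L]
    {𝒢 : ZMod 2 → Submodule ℂ L} [DirectSum.Decomposition 𝒢] (𝔤 : LieSuperalgebra 𝒢) :
    Algebra ℂ 𝔤.Enveloping :=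
  inferInstanceAs (Algebra ℂ (RingQuot (EnvelopingRel 𝔤)))

/-- The canonical map of a Lie superalgebra to its enveloping algebra. -/
noncomputable def ι {L : Type*} [AddCommGroup L] [Module ℂ L]
    {𝒢 : ZMod 2 → Submodule ℂ L} [DirectSum.Decomposition 𝒢] (𝔤 : LieSuperalgebra 𝒢) :
    L →ₗ[ℂ] 𝔤.Enveloping :=
  (RingQuot.mkAlgHom ℂ (EnvelopingRel 𝔤)).toLinearMap ∘ₗ TensorAlgebra.ι ℂ

theorem ι_superComm {L : Type*} [AddCommGroup L] [Module ℂ L]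
    {𝒢 : ZMod 2 → Submodule ℂ L} [DirectSum.Decomposition 𝒢] (𝔤 : LieSuperalgebra 𝒢)
    {i j : ZMod 2} {x y : L} (hx : x ∈ 𝒢 i) (hy : y ∈ 𝒢 j) :
    ι 𝔤 x * ι 𝔤 y - superSign i j • (ι 𝔤 y * ι 𝔤 x) = ι 𝔤 (𝔤.bracket x y) := by
  have h := RingQuot.mkAlgHom_rel ℂ (EnvelopingRel.superComm (𝔤 := 𝔤) hx hy)
  rw [map_sub, map_smul, map_mul, map_mul] at h
  exact h

/-- The parity automorphism of the enveloping algebra, extending the parity operator of the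
Lie superalgebra. -/
noncomputable def parity {L : Type*} [AddCommGroup L] [Module ℂ L]
    {𝒢 : ZMod 2 → Submodule ℂ L} [DirectSum.Decomposition 𝒢] (𝔤 : LieSuperalgebra 𝒢) :
    𝔤.Enveloping →ₐ[ℂ] 𝔤.Enveloping :=
  RingQuot.liftAlgHom ℂ ⟨TensorAlgebra.lift ℂ (ι 𝔤 ∘ₗ parityMap 𝒢), by
    rintro _ _ ⟨hx, hy⟩
    rename_i i j x y
    have h := ι_superComm 𝔤 hx hy
    have hs : (-1 : ℂ) ^ (i + j).val = (-1 : ℂ) ^ i.val * (-1 : ℂ) ^ j.val := by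
      have hi := zmodTwo_cases i
      have hj := zmodTwo_cases j
      rcases hi with rfl | rfl <;> rcases hj with rfl | rfl <;>
        simp [ZMod.val_one, show (1 + 1 : ZMod 2) = 0 from by decide]
    simp only [map_sub, map_mul, map_smul, TensorAlgebra.lift_ι_apply, LinearMap.comp_apply,
      parityMap_of_mem 𝒢 hx, parityMap_of_mem 𝒢 hy, parityMap_of_mem 𝒢 (𝔤.bracket_mem hx hy)]
    rw [hs, ← h]
    simp only [smul_mul_assoc, mul_smul_comm, smul_sub, smul_smul]
    congr 2 <;> ring⟩

@[simp]
theorem parity_ι {L : Type*} [AddCommGroup L] [Module ℂ L]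
    {𝒢 : ZMod 2 → Submodule ℂ L} [DirectSum.Decomposition 𝒢] (𝔤 : LieSuperalgebra 𝒢) (x : L) :
    parity 𝔤 (ι 𝔤 x) = ι 𝔤 (parityMap 𝒢 x) := by
  change RingQuot.liftAlgHom ℂ _ (RingQuot.mkAlgHom ℂ _ _) = _
  rw [RingQuot.liftAlgHom_mkAlgHom_apply, TensorAlgebra.lift_ι_apply]
  rfl

theorem parity_parity {L : Type*} [AddCommGroup L] [Module ℂ L]
    {𝒢 : ZMod 2 → Submodule ℂ L} [DirectSum.Decomposition 𝒢] (𝔤 : LieSuperalgebra 𝒢)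
    (u : 𝔤.Enveloping) : parity 𝔤 (parity 𝔤 u) = u := by
  suffices h : (parity 𝔤).comp (parity 𝔤) = AlgHom.id ℂ _ from DFunLike.congr_fun h u
  refine RingQuot.ringQuot_ext' _ _ _ (TensorAlgebra.hom_ext ?_)
  refine superDecomposition_ext 𝒢 fun i x hx => ?_
  change parity 𝔤 (parity 𝔤 (ι 𝔤 x)) = ι 𝔤 x
  rw [parity_ι, parityMap_of_mem 𝒢 hx, map_smul, map_smul, parity_ι, parityMap_of_mem 𝒢 hx,
    map_smul, smul_smul, ← mul_pow]
  simp

/-- The `ZMod 2`-grading of the enveloping algebra: even (resp. odd) elements are those that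
the parity automorphism fixes (resp. changes into their opposite). -/
noncomputable def grading {L : Type*} [AddCommGroup L] [Module ℂ L]
    {𝒢 : ZMod 2 → Submodule ℂ L} [DirectSum.Decomposition 𝒢] (𝔤 : LieSuperalgebra 𝒢) :
    ZMod 2 → Submodule ℂ 𝔤.Enveloping :=
  fun i => LinearMap.ker ((parity 𝔤).toLinearMap - (-1 : ℂ) ^ i.val • LinearMap.id)

theorem mem_grading {L : Type*} [AddCommGroup L] [Module ℂ L]
    {𝒢 : ZMod 2 → Submodule ℂ L} [DirectSum.Decomposition 𝒢] (𝔤 : LieSuperalgebra 𝒢)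
    {i : ZMod 2} {u : 𝔤.Enveloping} :
    u ∈ grading 𝔤 i ↔ parity 𝔤 u = (-1 : ℂ) ^ i.val • u := by
  simp [grading, sub_eq_zero]

noncomputable instance {L : Type*} [AddCommGroup L] [Module ℂ L]
    {𝒢 : ZMod 2 → Submodule ℂ L} [DirectSum.Decomposition 𝒢] (𝔤 : LieSuperalgebra 𝒢) :
    GradedAlgebra (grading 𝔤) where
  one_mem := by simp [mem_grading]
  mul_mem := by
    intro i j x y hx hy
    rw [mem_grading] at *
    rw [map_mul, hx, hy, smul_mul_smul_comm]
    congr 1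
    have hi := zmodTwo_cases i
    have hj := zmodTwo_cases j
    rcases hi with rfl | rfl <;> rcases hj with rfl | rfl <;>
      simp [ZMod.val_one, show (1 + 1 : ZMod 2) = 0 from by decide]
  toDecomposition := superDecomposition (grading 𝔤)
    ((1 / 2 : ℂ) • (LinearMap.id + (parity 𝔤).toLinearMap))
    (fun u => by simp [mem_grading, parity_parity, add_comm])
    (fun u => by
      simp only [mem_grading, LinearMap.smul_apply, LinearMap.add_apply, LinearMap.id_apply,
        AlgHom.toLinearMap_apply, map_sub, map_smul, map_add, parity_parity, ZMod.val_one]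
      module)
    (fun u hu => by
      have h : parity 𝔤 u = u := by simpa [mem_grading] using hu
      simp only [LinearMap.smul_apply, LinearMap.add_apply, LinearMap.id_apply,
        AlgHom.toLinearMap_apply, h]
      module)
    (fun u hu => by
      have h : parity 𝔤 u = -u := by simpa [mem_grading, ZMod.val_one] using hu
      simp [h])

/-- The action of the symmetric group `𝔖₂` on the enveloping algebra, the non-trivial element
acting by the parity automorphism. -/
noncomputable instance {L : Type*} [AddCommGroup L] [Module ℂ L]
    {𝒢 : ZMod 2 → Submodule ℂ L} [DirectSum.Decomposition 𝒢] (𝔤 : LieSuperalgebra 𝒢) :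
    MulSemiringAction (Equiv.Perm (Fin 2)) 𝔤.Enveloping where
  smul g u := if g = 1 then u else parity 𝔤 u
  one_smul u := if_pos rfl
  mul_smul g h u := by
    change (if g * h = 1 then u else parity 𝔤 u) =
      if g = 1 then (if h = 1 then u else parity 𝔤 u)
      else parity 𝔤 (if h = 1 then u else parity 𝔤 u)
    have key : ∀ g h : Equiv.Perm (Fin 2), g ≠ 1 → h ≠ 1 → g * h = 1 := by decide
    by_cases hg : g = 1
    · simp [hg]
    · by_cases hh : h = 1
      · simp [hh]
      · simp [hg, hh, key g h hg hh, parity_parity]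
  smul_zero g := by
    change (if g = 1 then 0 else parity 𝔤 0) = 0
    simp
  smul_add g u v := by
    change (if g = 1 then u + v else parity 𝔤 (u + v)) =
      (if g = 1 then u else parity 𝔤 u) + (if g = 1 then v else parity 𝔤 v)
    split_ifs <;> simp
  smul_one g := by
    change (if g = 1 then 1 else parity 𝔤 1) = 1
    simp
  smul_mul g u v := by
    change (if g = 1 then u * v else parity 𝔤 (u * v)) =
      (if g = 1 then u else parity 𝔤 u) * (if g = 1 then v else parity 𝔤 v)
    split_ifs <;> simp

theorem perm_smul_def {L : Type*} [AddCommGroup L] [Module ℂ L]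
    {𝒢 : ZMod 2 → Submodule ℂ L} [DirectSum.Decomposition 𝒢] (𝔤 : LieSuperalgebra 𝒢)
    (g : Equiv.Perm (Fin 2)) (u : 𝔤.Enveloping) :
    g • u = if g = 1 then u else parity 𝔤 u := rfl

instance {L : Type*} [AddCommGroup L] [Module ℂ L]
    {𝒢 : ZMod 2 → Submodule ℂ L} [DirectSum.Decomposition 𝒢] (𝔤 : LieSuperalgebra 𝒢) :
    SMulCommClass (Equiv.Perm (Fin 2)) ℂ 𝔤.Enveloping where
  smul_comm g c u := by
    simp only [perm_smul_def]
    split_ifs <;> simp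

end Enveloping

end LieSuperalgebra

/-! ### The Lie superalgebra `𝔬𝔰𝔭(1,2)` -/

/-- The standard basis `E₊, E₋ | Y, F, G` of `𝔬𝔰𝔭(1,2)`. -/
inductive OspBasis
  | Ep | Em | Y | F | G
  deriving DecidableEq

instance : Fintype OspBasis where
  elems := {.Ep, .Em, .Y, .F, .G}
  complete b := by cases b <;> decide

namespace OspBasis

/-- `E₊` and `E₋` are odd, `Y`, `F` and `G` are even. -/
def parity : OspBasis → ZMod 2
  | Ep => 1
  | Em => 1
  | Y => 0
  | F => 0
  | G => 0

/-- The vector of the basis `b`, in the space `ℂ⁵` of coordinate vectors. -/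
def vec (b : OspBasis) : OspBasis → ℂ := Pi.single b 1

/-- The superbrackets of the elements of the basis. -/
noncomputable def table : OspBasis → OspBasis → (OspBasis → ℂ)
  | Y, Ep => (1 / 2 : ℂ) • vec Ep
  | Ep, Y => -(1 / 2 : ℂ) • vec Ep
  | Y, Em => -(1 / 2 : ℂ) • vec Em
  | Em, Y => (1 / 2 : ℂ) • vec Em
  | Y, F => vec F
  | F, Y => -vec F
  | Y, G => -vec G
  | G, Y => vec G
  | F, G => (2 : ℂ) • vec Y
  | G, F => -(2 : ℂ) • vec Y
  | F, Em => -vec Ep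
  | Em, F => vec Ep
  | G, Ep => -vec Em
  | Ep, G => vec Em
  | Ep, Ep => vec F
  | Em, Em => -vec G
  | Ep, Em => vec Y
  | Em, Ep => vec Y
  | _, _ => 0

end OspBasis

/-- The even and odd parts of `𝔬𝔰𝔭(1,2)`: the spans of `Y, F, G` and of `E₊, E₋`. -/
def ospGrading (i : ZMod 2) : Submodule ℂ (OspBasis → ℂ) where
  carrier := {x | ∀ b, b.parity ≠ i → x b = 0}
  add_mem' hx hy b hb := by simp [hx b hb, hy b hb]
  zero_mem' _ _ := rfl
  smul_mem' c x hx b hb := by simp [hx b hb]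

noncomputable instance : DirectSum.Decomposition ospGrading :=
  superDecomposition ospGrading
    (LinearMap.pi fun b => if b.parity = 0 then LinearMap.proj b else 0)
    (fun x b hb => by simp [hb])
    (fun x b hb => by
      have : b.parity = 0 := by revert hb; cases b <;> decide
      simp [this])
    (fun x hx => by
      funext b
      by_cases hb : b.parity = 0
      · simp [hb]
      · simp [hb, hx b hb])
    (fun x hx => by
      funext b
      by_cases hb : b.parity = 0
      · simp [hb, hx b (by rw [hb]; decide)]
      · simp [hb])

/-- The sum over the basis, written out. -/
theorem OspBasis.sum_eq {M : Type*} [AddCommMonoid M] (f : OspBasis → M) :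
    ∑ b, f b = f .Ep + (f .Em + (f .Y + (f .F + f .G))) := by
  change ∑ b ∈ ({.Ep, .Em, .Y, .F, .G} : Finset OspBasis), f b = _
  simp

/-- The bilinear extension of the table of superbrackets. -/
noncomputable def ospBracket :
    (OspBasis → ℂ) →ₗ[ℂ] (OspBasis → ℂ) →ₗ[ℂ] (OspBasis → ℂ) :=
  LinearMap.mk₂ ℂ (fun x y => ∑ a, ∑ b, (x a * y b) • OspBasis.table a b)
    (fun x x' y => by simp [add_mul, add_smul, Finset.sum_add_distrib])
    (fun c x y => by simp [Finset.smul_sum, smul_smul, mul_assoc])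
    (fun x y y' => by simp [mul_add, add_smul, Finset.sum_add_distrib])
    (fun c x y => by simp [Finset.smul_sum, smul_smul, mul_left_comm])

theorem ospBracket_vec (a b : OspBasis) :
    ospBracket a.vec b.vec = OspBasis.table a b := by
  simp [ospBracket, OspBasis.vec, Pi.single_apply, ite_smul]

theorem ospBracket_coords (x y : OspBasis → ℂ) :
    ospBracket x y = fun
      | .Ep => (x .Y * y .Ep - x .Ep * y .Y) / 2 + x .Em * y .F - x .F * y .Em
      | .Em => (x .Em * y .Y - x .Y * y .Em) / 2 + x .Ep * y .G - x .G * y .Ep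
      | .Y => 2 * (x .F * y .G - x .G * y .F) + x .Ep * y .Em + x .Em * y .Ep
      | .F => x .Y * y .F - x .F * y .Y + x .Ep * y .Ep
      | .G => x .G * y .Y - x .Y * y .G - x .Em * y .Em := by
  funext b
  cases b <;>
    simp [ospBracket, OspBasis.sum_eq, OspBasis.table, OspBasis.vec] <;> ring

theorem ospGrading_zero {x : OspBasis → ℂ} (hx : x ∈ ospGrading 0) :
    x .Ep = 0 ∧ x .Em = 0 := ⟨hx _ (by decide), hx _ (by decide)⟩

theorem ospGrading_one {x : OspBasis → ℂ} (hx : x ∈ ospGrading 1) :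
    x .Y = 0 ∧ x .F = 0 ∧ x .G = 0 := ⟨hx _ (by decide), hx _ (by decide), hx _ (by decide)⟩

/-- The Lie superalgebra `𝔬𝔰𝔭(1,2)`. -/
noncomputable def osp12 : LieSuperalgebra ospGrading where
  bracket := ospBracket
  bracket_mem := by
    intro i j x y hx hy b hb
    have hi := zmodTwo_cases i
    have hj := zmodTwo_cases j
    rw [ospBracket_coords]
    rcases hi with rfl | rfl <;> rcases hj with rfl | rfl <;>
    first
      | obtain ⟨h1, h2⟩ := ospGrading_zero hx
      | obtain ⟨h1, h2, h3⟩ := ospGrading_one hx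
    all_goals
      first
        | obtain ⟨k1, k2⟩ := ospGrading_zero hy
        | obtain ⟨k1, k2, k3⟩ := ospGrading_one hy
    all_goals
      cases b <;> first
        | exact absurd (by decide) hb
        | simp [*]
  skew := by
    intro i j x y hx hy
    have hi := zmodTwo_cases i
    have hj := zmodTwo_cases j
    rw [ospBracket_coords, ospBracket_coords]
    rcases hi with rfl | rfl <;> rcases hj with rfl | rfl <;>
    first
      | obtain ⟨h1, h2⟩ := ospGrading_zero hx
      | obtain ⟨h1, h2, h3⟩ := ospGrading_one hx
    all_goals
      first
        | obtain ⟨k1, k2⟩ := ospGrading_zero hy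
        | obtain ⟨k1, k2, k3⟩ := ospGrading_one hy
    all_goals
      funext b
      cases b <;> simp [*, superSign, ZMod.val_one] <;> ring
  jacobi := by
    intro i j k x y z hx hy hz
    have hi := zmodTwo_cases i
    have hj := zmodTwo_cases j
    have hk := zmodTwo_cases k
    simp only [ospBracket_coords]
    rcases hi with rfl | rfl <;> rcases hj with rfl | rfl <;> rcases hk with rfl | rfl <;>
    first
      | obtain ⟨h1, h2⟩ := ospGrading_zero hx
      | obtain ⟨h1, h2, h3⟩ := ospGrading_one hx
    all_goals
      first
        | obtain ⟨k1, k2⟩ := ospGrading_zero hy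
        | obtain ⟨k1, k2, k3⟩ := ospGrading_one hy
    all_goals
      first
        | obtain ⟨l1, l2⟩ := ospGrading_zero hz
        | obtain ⟨l1, l2, l3⟩ := ospGrading_one hz
    all_goals
      funext b
      cases b <;> simp [*, superSign, ZMod.val_one] <;> ring

/-- The enveloping algebra `𝒰 = 𝒰(𝔬𝔰𝔭(1,2))`. -/
abbrev UOsp : Type := osp12.Enveloping

namespace UOsp

/-- The generator `E₊` of `𝒰`. -/
noncomputable def Ep : UOsp := LieSuperalgebra.Enveloping.ι osp12 OspBasis.Ep.vec

/-- The generator `E₋` of `𝒰`. -/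
noncomputable def Em : UOsp := LieSuperalgebra.Enveloping.ι osp12 OspBasis.Em.vec

/-- The ghost `θ = 1/4 + (E₊ E₋ - E₋ E₊)`. -/
noncomputable def ghost : UOsp := algebraMap ℂ UOsp (1 / 4) + (Ep * Em - Em * Ep)

/-- The grading of `𝒰` by parity. -/
noncomputable abbrev grading : ZMod 2 → Submodule ℂ UOsp :=
  LieSuperalgebra.Enveloping.grading osp12

/-- The smash product `𝔖₂ ⋉ 𝒰`, for the action of `𝔖₂` by parity: the vector space
`𝒰 ⊗ ℂ[𝔖₂]` with product `(a ⊗ g)(a' ⊗ g') = a (g • a') ⊗ g g'`. -/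
abbrev Smash : Type := SkewMonoidAlgebra UOsp (Equiv.Perm (Fin 2))

end UOsp

/-! ### Clifford algebras -/

/-- The quadratic form `v ↦ ∑ vᵢ²` on `ℂᵐ`. -/
noncomputable abbrev stdForm (m : ℕ) : QuadraticForm ℂ (Fin m → ℂ) :=
  QuadraticMap.weightedSumSquares ℂ (fun _ : Fin m => (1 : ℂ))

/-- The complex Clifford algebra `𝒞(m)` in `m` generators. -/
abbrev Cl (m : ℕ) : Type := CliffordAlgebra (stdForm m)

namespace Cl

/-- The generators `ω_j` of `𝒞(m)`, with `ω_j ω_k + ω_k ω_j = 2 δ_jk`. -/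
noncomputable def ω {m : ℕ} (j : Fin m) : Cl m :=
  CliffordAlgebra.ι (stdForm m) (Pi.single j 1)

theorem ω_anticomm {m : ℕ} (j k : Fin m) :
    (ω j * ω k + ω k * ω j : Cl m) = if j = k then 2 else 0 := by
  rw [ω, ω, CliffordAlgebra.ι_mul_ι_add_swap]
  split_ifs with h
  · subst h
    have : QuadraticMap.polar (stdForm m) (Pi.single j 1) (Pi.single j 1) = 2 := by
      rw [QuadraticMap.polar_self, QuadraticMap.weightedSumSquares_apply]
      simp [Pi.single_apply]
    rw [this, map_ofNat]
  · have : QuadraticMap.polar (stdForm m) (Pi.single j 1) (Pi.single k 1) = 0 := by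
      simp only [QuadraticMap.polar, QuadraticMap.weightedSumSquares_apply, one_smul,
        ← Finset.sum_sub_distrib]
      refine Finset.sum_eq_zero fun i _ => ?_
      by_cases h1 : i = j
      · subst h1; simp [h]
      · simp [Pi.single_apply, h1]
    rw [this, map_zero]

/-- The ordered product `ω₁ ⋯ ω_m` in `𝒞(m)`. -/
noncomputable def volume (m : ℕ) : Cl m := (List.ofFn fun j : Fin m => (ω j : Cl m)).prod

/-- The grading of `𝒞(m)` in which the generators are odd. -/
noncomputable abbrev grading (m : ℕ) : ZMod 2 → Submodule ℂ (Cl m) :=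
  CliffordAlgebra.evenOdd (stdForm m)

end Cl

/-! ### The algebra `𝒜_Λ(n)` -/

/-- The generators `ω₁, …, ω_{2n+1}, E₊, E₋, Λ`. -/
inductive AGen (n : ℕ)
  | ω (j : Fin (2 * n + 1))
  | Ep
  | Em
  | Lam

/-- The defining relations of `𝒜_Λ(n)`. -/
inductive ARel (n : ℕ) : FreeAlgebra ℂ (AGen n) → FreeAlgebra ℂ (AGen n) → Prop
  | central (g : AGen n) :
      ARel n (FreeAlgebra.ι ℂ AGen.Lam * FreeAlgebra.ι ℂ g)
        (FreeAlgebra.ι ℂ g * FreeAlgebra.ι ℂ AGen.Lam)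
  | comm :
      ARel n
        (FreeAlgebra.ι ℂ AGen.Ep * FreeAlgebra.ι ℂ AGen.Em -
          FreeAlgebra.ι ℂ AGen.Em * FreeAlgebra.ι ℂ AGen.Ep)
        (algebraMap ℂ _ (-1 / 4) +
          Complex.I ^ n • (FreeAlgebra.ι ℂ AGen.Lam *
            (List.ofFn fun j : Fin (2 * n + 1) => FreeAlgebra.ι ℂ (AGen.ω j)).prod))
  | clifford (j k : Fin (2 * n + 1)) :
      ARel n
        (FreeAlgebra.ι ℂ (AGen.ω j) * FreeAlgebra.ι ℂ (AGen.ω k) +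
          FreeAlgebra.ι ℂ (AGen.ω k) * FreeAlgebra.ι ℂ (AGen.ω j))
        (if j = k then 2 else 0)
  | anticommEp (j : Fin (2 * n + 1)) :
      ARel n (FreeAlgebra.ι ℂ AGen.Ep * FreeAlgebra.ι ℂ (AGen.ω j))
        (-(FreeAlgebra.ι ℂ (AGen.ω j) * FreeAlgebra.ι ℂ AGen.Ep))
  | anticommEm (j : Fin (2 * n + 1)) :
      ARel n (FreeAlgebra.ι ℂ AGen.Em * FreeAlgebra.ι ℂ (AGen.ω j))
        (-(FreeAlgebra.ι ℂ (AGen.ω j) * FreeAlgebra.ι ℂ AGen.Em))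

/-- The `ℂ`-algebra `𝒜_Λ(n)`, by generators and relations. -/
def AΛ (n : ℕ) : Type := RingQuot (ARel n)

namespace AΛ

noncomputable instance (n : ℕ) : Ring (AΛ n) := inferInstanceAs (Ring (RingQuot (ARel n)))

noncomputable instance (n : ℕ) : Algebra ℂ (AΛ n) :=
  inferInstanceAs (Algebra ℂ (RingQuot (ARel n)))

/-- The image of a generator in `𝒜_Λ(n)`. -/
noncomputable def gen {n : ℕ} (g : AGen n) : AΛ n :=
  RingQuot.mkAlgHom ℂ (ARel n) (FreeAlgebra.ι ℂ g)

end AΛ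

/-!
The argument compares presentations by generators and relations. The ghost `θ = 1/4 + [E₊, E₋]`
anticommutes with `E₊` and `E₋`. Conversely these two relations say that `[2 E₊², E₋] = -E₊` and
`[-2 E₋², E₊] = -E₋`, and all the superbrackets of `𝔬𝔰𝔭(1,2)` follow from them if `Y`, `F` and `G`
are defined by `Y = E₊ E₋ + E₋ E₊`, `F = 2 E₊²` and `G = -2 E₋²`. Hence `𝒰` is presented by `E₊`,
`E₋` and these two relations (`UOsp.lift`, `UOsp.algHom_ext`).

In `𝒜_Λ(n)` the element `i^n ω₁ ⋯ ω_{2n+1}` is an involution that commutes with every `ω_j` and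
anticommutes with `E₊` and `E₋`. The relation for `[E₊, E₋]` therefore amounts to
`Λ = i^n ω₁ ⋯ ω_{2n+1} θ`, and the centrality of `Λ` to the anticommutation of `θ` with `E₊` and
`E₋`. So `𝒜_Λ(n)` is presented by Clifford generators `ω_j` and an `𝔬𝔰𝔭(1,2)` pair `E₊`, `E₋` that
anticommutes with them (`AΛ.lift`, `AΛ.algHom_ext`). This is also the presentation of the graded
tensor product `𝒞(2n+1) ⊗ 𝒰`, whence `AΛ.gradedTensorEquiv`; the image of `Λ` is central because
`Λ` is.

Let `Γ = i^n ω₁ ⋯ ω_{2n}`, an involution that anticommutes with `ω₁, …, ω_{2n}` and commutes with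
`E₊`, `E₋` and `ω_{2n+1}`. Then `Γ E₊`, `Γ E₋` and `s = Γ ω_{2n+1}` commute with `ω₁, …, ω_{2n}`;
the first two form an `𝔬𝔰𝔭(1,2)` pair with the same ghost, and `s` is an involution that
anticommutes with both. Those are the relations of the smash product `𝔖₂ ⋉ 𝒰`, and the change of
generators can be inverted, as `Γ² = 1` (`AΛ.tensorEquiv`). Finally
`𝒞(m+2) ≃ 𝒞(m) ⊗ M₂(ℂ)` by means of the Pauli matrices (`Cl.tensorMatrixEquiv`), so that `𝒞(2n)` is
the algebra of matrices of size `2^n`.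
-/

/-! ### Clifford families -/

section CliffordFamily

variable {A : Type*} [Ring A] {m : ℕ}

/-- A family of elements of an algebra that satisfies the relations
`g_j g_k + g_k g_j = 2 δ_jk` of the generators of a Clifford algebra. -/
def IsCliffordFamily (g : Fin m → A) : Prop :=
  ∀ j k, g j * g k + g k * g j = if j = k then 2 else 0

theorem IsCliffordFamily.anticomm {g : Fin m → A} (hg : IsCliffordFamily g) {j k : Fin m}
    (hjk : j ≠ k) : g j * g k = -(g k * g j) := by
  have h := hg j k
  rw [if_neg hjk] at h
  exact eq_neg_of_add_eq_zero_left h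

theorem isCliffordFamily_of_sq_of_anticomm {g : Fin m → A} (h1 : ∀ j, g j * g j = 1)
    (h2 : ∀ j k, j ≠ k → g j * g k = -(g k * g j)) : IsCliffordFamily g := by
  intro j k
  split_ifs with h
  · subst h
    rw [h1, one_add_one_eq_two]
  · rw [h2 j k h, neg_add_cancel]

theorem IsCliffordFamily.castSucc {g : Fin (m + 1) → A} (hg : IsCliffordFamily g) :
    IsCliffordFamily fun j : Fin m => g j.castSucc := by
  intro j k
  simp [hg j.castSucc k.castSucc]

variable [Algebra ℂ A]

theorem IsCliffordFamily.sq {g : Fin m → A} (hg : IsCliffordFamily g) (j : Fin m) :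
    g j * g j = 1 := by
  have h := hg j j
  rw [if_pos rfl, ← one_add_one_eq_two, ← two_smul ℂ, ← two_smul ℂ] at h
  exact smul_right_injective A (two_ne_zero' ℂ) h

theorem IsCliffordFamily.map {B : Type*} [Ring B] [Algebra ℂ B] {g : Fin m → A}
    (hg : IsCliffordFamily g) (φ : A →ₐ[ℂ] B) : IsCliffordFamily fun j => φ (g j) := by
  intro j k
  rw [← map_mul, ← map_mul, ← map_add, hg j k]
  split_ifs
  · exact map_ofNat φ 2
  · exact map_zero φ

theorem IsCliffordFamily.snoc {g : Fin m → A} (hg : IsCliffordFamily g) {x : A} (hx : x * x = 1)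
    (hgx : ∀ j, g j * x = -(x * g j)) : IsCliffordFamily (Fin.snoc g x : Fin (m + 1) → A) := by
  refine isCliffordFamily_of_sq_of_anticomm (fun j => ?_) fun j k => ?_
  · induction j using Fin.lastCases with
    | last => simp [hx]
    | cast j => simp [hg.sq]
  · induction j using Fin.lastCases with
    | last =>
      induction k using Fin.lastCases with
      | last => simp
      | cast k => simp [hgx]
    | cast j =>
      induction k using Fin.lastCases with
      | last => simp [hgx]
      | cast k =>
        intro h
        simpa using hg.anticomm fun hjk => h (congrArg _ hjk)

theorem isCliffordFamily_ω : IsCliffordFamily (Cl.ω : Fin m → Cl m) := Cl.ω_anticomm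

theorem Cl.ι_eq_sum (v : Fin m → ℂ) :
    CliffordAlgebra.ι (stdForm m) v = ∑ j, v j • (Cl.ω j : Cl m) := by
  conv_lhs => rw [pi_eq_sum_univ' v]
  simp only [map_sum, map_smul]
  rfl

theorem IsCliffordFamily.sum_sq {g : Fin m → A} (hg : IsCliffordFamily g) (v : Fin m → ℂ) :
    Fintype.linearCombination ℂ g v * Fintype.linearCombination ℂ g v =
      algebraMap ℂ A (stdForm m v) := by
  simp only [Fintype.linearCombination_apply]
  apply smul_right_injective A (two_ne_zero' ℂ)
  have h : ∀ j k, (v j • g j) * (v k • g k) + (v k • g k) * (v j • g j) =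
      if j = k then (2 * (v j * v j)) • (1 : A) else 0 := by
    intro j k
    rw [smul_mul_smul_comm, smul_mul_smul_comm, mul_comm (v k), ← smul_add, hg j k]
    split_ifs with hjk
    · subst hjk
      rw [mul_comm (2 : ℂ), mul_smul _ (2 : ℂ), two_smul, one_add_one_eq_two]
    · rw [smul_zero]
  change (2 : ℂ) • _ = (2 : ℂ) • _
  rw [two_smul]
  nth_rw 2 [Finset.sum_mul_sum]
  rw [Finset.sum_comm, Finset.sum_mul_sum, ← Finset.sum_add_distrib]
  simp only [← Finset.sum_add_distrib, h, Finset.sum_ite_eq, Finset.mem_univ, if_true]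
  rw [← Finset.sum_smul, ← Finset.mul_sum, mul_smul, Algebra.algebraMap_eq_smul_one]
  simp [QuadraticMap.weightedSumSquares_apply]

namespace Cl

/-- The universal property of `𝒞(m)` by generators and relations. -/
noncomputable def lift {g : Fin m → A} (hg : IsCliffordFamily g) : Cl m →ₐ[ℂ] A :=
  CliffordAlgebra.lift (stdForm m) ⟨Fintype.linearCombination ℂ g, hg.sum_sq⟩

@[simp]
theorem lift_ω {g : Fin m → A} (hg : IsCliffordFamily g) (j : Fin m) :
    lift hg (ω j) = g j := by
  rw [lift, ω, CliffordAlgebra.lift_ι_apply]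
  simp

theorem algHom_ext {f g : Cl m →ₐ[ℂ] A} (h : ∀ j, f (ω j) = g (ω j)) : f = g := by
  refine CliffordAlgebra.hom_ext (LinearMap.ext fun v => ?_)
  change f (CliffordAlgebra.ι _ v) = g (CliffordAlgebra.ι _ v)
  simp only [ι_eq_sum, map_sum, map_smul, h]

theorem adjoin_eq_top (m : ℕ) : Algebra.adjoin ℂ (Set.range (ω : Fin m → Cl m)) = ⊤ := by
  refine top_unique ?_
  rw [← CliffordAlgebra.adjoin_range_ι, Algebra.adjoin_le_iff]
  rintro _ ⟨v, rfl⟩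
  rw [ι_eq_sum]
  exact Subalgebra.sum_mem _ fun j _ =>
    Subalgebra.smul_mem _ (Algebra.subset_adjoin (Set.mem_range_self j)) _

end Cl

theorem mul_prod_ofFn_of_anticomm {g : Fin m → A} {x : A} (h : ∀ j, x * g j = -(g j * x)) :
    x * (List.ofFn g).prod = (-1 : ℂ) ^ m • ((List.ofFn g).prod * x) := by
  induction m with
  | zero => simp
  | succ m ih =>
    rw [List.ofFn_succ, List.prod_cons, ← mul_assoc, h, neg_mul, mul_assoc,
      ih fun j => h j.succ, mul_smul_comm, pow_succ, mul_assoc]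
    module

theorem IsCliffordFamily.prod_ofFn_even_sq (n : ℕ) {g : Fin (2 * n) → A}
    (hg : IsCliffordFamily g) :
    (List.ofFn g).prod * (List.ofFn g).prod = (-1 : ℂ) ^ n • (1 : A) := by
  -- Moving the last factor across the first product costs `(-1)^k`; two successive steps cost
  -- `(-1)^(2n) (-1)^(2n+1) = -1`.
  have step : ∀ (k : ℕ) (g : Fin (k + 1) → A), IsCliffordFamily g →
      (List.ofFn g).prod * (List.ofFn g).prod = (-1 : ℂ) ^ k •
        ((List.ofFn fun j : Fin k => g j.castSucc).prod *
          (List.ofFn fun j : Fin k => g j.castSucc).prod) := by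
    intro k g hg
    have h := mul_prod_ofFn_of_anticomm (g := fun j : Fin k => g j.castSucc)
      (x := g (Fin.last k)) fun j => hg.anticomm (Fin.castSucc_lt_last j).ne'
    rw [List.ofFn_succ', List.concat_eq_append, List.prod_append, List.prod_singleton]
    rw [mul_assoc, ← mul_assoc (g (Fin.last k)), h, smul_mul_assoc, mul_assoc _ (g (Fin.last k)),
      hg.sq, mul_one, mul_smul_comm]
  induction n with
  | zero => simp
  | succ n ih =>
    have h := step (2 * n) (fun j => g j.castSucc) hg.castSucc
    have h' := ih (g := fun j => g (Fin.castSucc (n := 2 * n + 1) (Fin.castSucc j)))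
      hg.castSucc.castSucc
    refine (step (2 * n + 1) g hg).trans ?_
    rw [h, h']
    simp [smul_smul, pow_succ, pow_mul]

end CliffordFamily

/-! ### The enveloping algebra of `𝔬𝔰𝔭(1,2)` by generators and relations -/

section Osp

variable {A : Type*} [Ring A] [Algebra ℂ A]

/-- The element `1/4 + (e f - f e)`; it is the ghost when `e = E₊` and `f = E₋`. -/
noncomputable def ghostOf (e f : A) : A := algebraMap ℂ A (1 / 4) + (e * f - f * e)

/-- Two elements that anticommute with their ghost. These relations present the enveloping algebra
of `𝔬𝔰𝔭(1,2)`, see `UOsp.lift`. -/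
structure IsOspPair (e f : A) : Prop where
  left : ghostOf e f * e = -(e * ghostOf e f)
  right : ghostOf e f * f = -(f * ghostOf e f)

/-- The relations of an `𝔬𝔰𝔭(1,2)` pair are the brackets of `F = 2 E₊²` with `E₋` and of
`G = -2 E₋²` with `E₊`. -/
theorem isOspPair_iff {e f : A} : IsOspPair e f ↔
    e * (e * f) - f * (e * e) = -(1 / 2 : ℂ) • e ∧
      e * (f * f) - f * (f * e) = -(1 / 2 : ℂ) • f := by
  have h1 : ghostOf e f * e - -(e * ghostOf e f) =
      e * (e * f) - f * (e * e) - -(1 / 2 : ℂ) • e := by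
    simp only [ghostOf, Algebra.algebraMap_eq_smul_one, add_mul, sub_mul, mul_add, mul_sub,
      smul_mul_assoc, mul_smul_comm, one_mul, mul_one, mul_assoc]
    module
  have h2 : ghostOf e f * f - -(f * ghostOf e f) =
      e * (f * f) - f * (f * e) - -(1 / 2 : ℂ) • f := by
    simp only [ghostOf, Algebra.algebraMap_eq_smul_one, add_mul, sub_mul, mul_add, mul_sub,
      smul_mul_assoc, mul_smul_comm, one_mul, mul_one, mul_assoc]
    module
  constructor
  · rintro ⟨k1, k2⟩
    rw [k1, sub_self] at h1
    rw [k2, sub_self] at h2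
    exact ⟨sub_eq_zero.1 h1.symm, sub_eq_zero.1 h2.symm⟩
  · rintro ⟨k1, k2⟩
    rw [k1, sub_self] at h1
    rw [k2, sub_self] at h2
    exact ⟨sub_eq_zero.1 h1, sub_eq_zero.1 h2⟩

theorem map_ghostOf {B : Type*} [Ring B] [Algebra ℂ B] (φ : A →ₐ[ℂ] B) (e f : A) :
    φ (ghostOf e f) = ghostOf (φ e) (φ f) := by
  simp only [ghostOf, map_add, map_sub, map_mul, AlgHom.commutes]

theorem IsOspPair.map {B : Type*} [Ring B] [Algebra ℂ B] {e f : A} (h : IsOspPair e f)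
    (φ : A →ₐ[ℂ] B) : IsOspPair (φ e) (φ f) := by
  constructor
  · rw [← map_ghostOf, ← map_mul, ← map_mul, ← map_neg, h.left]
  · rw [← map_ghostOf, ← map_mul, ← map_mul, ← map_neg, h.right]

/-- The images of the elements of the basis of `𝔬𝔰𝔭(1,2)`, given those of `E₊` and `E₋`. -/
noncomputable def ospImage (e f : A) : OspBasis → A
  | .Ep => e
  | .Em => f
  | .Y => e * f + f * e
  | .F => (2 : ℂ) • (e * e)
  | .G => (-2 : ℂ) • (f * f)

theorem IsOspPair.superComm_basis {e f : A} (h : IsOspPair e f) (a b : OspBasis) :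
    ospImage e f a * ospImage e f b -
        superSign a.parity b.parity • (ospImage e f b * ospImage e f a) =
      Fintype.linearCombination ℂ (ospImage e f) (OspBasis.table a b) := by
  obtain ⟨h1, h2⟩ := isOspPair_iff.1 h
  have l1 := congrArg (e * ·) h1
  have r1 := congrArg (· * e) h1
  have r1' := congrArg (· * f) h1
  have l1' := congrArg (f * ·) h1
  have l2 := congrArg (f * ·) h2
  have r2 := congrArg (· * f) h2
  simp only [mul_sub, sub_mul, mul_assoc, smul_mul_assoc, mul_smul_comm] at l1 r1 r1' l1' l2 r2
  -- Each superbracket that is neither a definition nor zero is a combination of `[F, E₋]` and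
  -- `[G, E₊]`, or of their products with `e` and `f`; the alternatives list the coefficients.
  cases a <;> cases b <;>
    simp only [ospImage, OspBasis.table, OspBasis.vec, OspBasis.parity, superSign, ZMod.val_one,
      ZMod.val_zero, map_smul, map_neg, map_zero, Fintype.linearCombination_apply_single, mul_add,
      add_mul, mul_assoc, smul_mul_assoc, mul_smul_comm, one_smul, pow_zero, mul_zero,
      mul_one, pow_one, smul_add, smul_smul] <;>
    first
      | module
      | linear_combination (norm := module) h1
      | linear_combination (norm := module) -h1
      | linear_combination (norm := module) h2
      | linear_combination (norm := module) -h2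
      | linear_combination (norm := module) (2 : ℂ) • h1
      | linear_combination (norm := module) (-2 : ℂ) • h1
      | linear_combination (norm := module) (2 : ℂ) • h2
      | linear_combination (norm := module) (-2 : ℂ) • h2
      | linear_combination (norm := module) (2 : ℂ) • (l1 + r1)
      | linear_combination (norm := module) (-2 : ℂ) • (l1 + r1)
      | linear_combination (norm := module) (2 : ℂ) • (l2 + r2)
      | linear_combination (norm := module) (-2 : ℂ) • (l2 + r2)
      | linear_combination (norm := module) (4 : ℂ) • (l1' + r1')
      | linear_combination (norm := module) (-4 : ℂ) • (l1' + r1')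

theorem ospGrading_eq_span (i : ZMod 2) :
    ospGrading i = Submodule.span ℂ (OspBasis.vec '' {b | b.parity = i}) := by
  apply le_antisymm
  · intro x hx
    rw [pi_eq_sum_univ' x]
    refine Submodule.sum_mem _ fun b _ => ?_
    by_cases hb : b.parity = i
    · exact Submodule.smul_mem _ _ (Submodule.subset_span ⟨b, hb, rfl⟩)
    · simp [hx b hb]
  · rw [Submodule.span_le]
    rintro _ ⟨b, hb, rfl⟩ c hc
    refine Pi.single_eq_of_ne ?_ _
    rintro rfl
    exact hc hb

theorem IsOspPair.superComm {e f : A} (h : IsOspPair e f) {i j : ZMod 2} {x y : OspBasis → ℂ}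
    (hx : x ∈ ospGrading i) (hy : y ∈ ospGrading j) :
    Fintype.linearCombination ℂ (ospImage e f) x * Fintype.linearCombination ℂ (ospImage e f) y -
        superSign i j • (Fintype.linearCombination ℂ (ospImage e f) y *
          Fintype.linearCombination ℂ (ospImage e f) x) =
      Fintype.linearCombination ℂ (ospImage e f) (osp12.bracket x y) := by
  rw [ospGrading_eq_span] at hx hy
  induction hx, hy using Submodule.span_induction₂ with
  | mem_mem x y hx hy =>
    obtain ⟨a, rfl, rfl⟩ := hx
    obtain ⟨b, rfl, rfl⟩ := hy
    change _ = Fintype.linearCombination ℂ (ospImage e f) (ospBracket a.vec b.vec)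
    rw [ospBracket_vec, ← h.superComm_basis]
    simp [OspBasis.vec, Fintype.linearCombination_apply_single]
  | zero_left y hy => simp
  | zero_right x hx => simp
  | add_left x y z hx hy hz h1 h2 =>
    simp only [map_add, LinearMap.add_apply, ← h1, ← h2, add_mul, mul_add, smul_add]
    abel
  | add_right x y z hx hy hz h1 h2 =>
    simp only [map_add, ← h1, ← h2, add_mul, mul_add, smul_add]
    abel
  | smul_left r x y hx hy h1 =>
    simp only [map_smul, LinearMap.smul_apply, ← h1, smul_mul_assoc, mul_smul_comm, smul_sub,
      smul_comm r]
  | smul_right r x y hx hy h1 =>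
    simp only [map_smul, ← h1, smul_mul_assoc, mul_smul_comm, smul_sub, smul_comm r]

namespace UOsp

open LieSuperalgebra

/-- The universal property of `𝒰(𝔬𝔰𝔭(1,2))`: it is generated by `E₊` and `E₋`, subject to the
relations that they anticommute with the ghost. -/
noncomputable def lift {e f : A} (h : IsOspPair e f) : UOsp →ₐ[ℂ] A :=
  RingQuot.liftAlgHom ℂ ⟨TensorAlgebra.lift ℂ (Fintype.linearCombination ℂ (ospImage e f)), by
    rintro _ _ ⟨hx, hy⟩
    simp only [map_sub, map_mul, map_smul, TensorAlgebra.lift_ι_apply]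
    exact h.superComm hx hy⟩

theorem lift_ι_vec {e f : A} (h : IsOspPair e f) (b : OspBasis) :
    lift h (Enveloping.ι osp12 b.vec) = ospImage e f b := by
  change RingQuot.liftAlgHom ℂ _ (RingQuot.mkAlgHom ℂ _ _) = _
  rw [RingQuot.liftAlgHom_mkAlgHom_apply, TensorAlgebra.lift_ι_apply, OspBasis.vec,
    Fintype.linearCombination_apply_single, one_smul]

@[simp]
theorem lift_Ep {e f : A} (h : IsOspPair e f) : lift h Ep = e := lift_ι_vec h .Ep

@[simp]
theorem lift_Em {e f : A} (h : IsOspPair e f) : lift h Em = f := lift_ι_vec h .Em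

theorem superComm_vec (a b : OspBasis) :
    Enveloping.ι osp12 a.vec * Enveloping.ι osp12 b.vec -
        superSign a.parity b.parity •
          (Enveloping.ι osp12 b.vec * Enveloping.ι osp12 a.vec) =
      Enveloping.ι osp12 (OspBasis.table a b) := by
  rw [← ospBracket_vec]
  refine Enveloping.ι_superComm osp12 ?_ ?_ <;>
  · rw [ospGrading_eq_span]
    exact Submodule.subset_span ⟨_, rfl, rfl⟩

theorem ι_vec (b : OspBasis) : Enveloping.ι osp12 b.vec = ospImage Ep Em b := by
  cases b with
  | Ep => rfl
  | Em => rfl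
  | Y =>
    have h := superComm_vec .Ep .Em
    simp only [OspBasis.parity, OspBasis.table, superSign, ZMod.val_one] at h
    rw [← h]
    simp [ospImage, Ep, Em]
  | F =>
    have h := superComm_vec .Ep .Ep
    simp only [OspBasis.parity, OspBasis.table, superSign, ZMod.val_one] at h
    rw [← h]
    simp [ospImage, Ep, two_smul]
  | G =>
    have h := superComm_vec .Em .Em
    simp only [OspBasis.parity, OspBasis.table, superSign, ZMod.val_one, map_neg] at h
    rw [← neg_neg (Enveloping.ι osp12 OspBasis.G.vec), ← h]
    simp [ospImage, Em, two_smul]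

theorem algHom_ext {f g : UOsp →ₐ[ℂ] A} (hp : f Ep = g Ep) (hm : f Em = g Em) : f = g := by
  refine RingQuot.ringQuot_ext' _ _ _ (TensorAlgebra.hom_ext (LinearMap.ext fun x => ?_))
  change f (Enveloping.ι osp12 x) = g (Enveloping.ι osp12 x)
  rw [pi_eq_sum_univ' x]
  simp only [map_sum, map_smul]
  refine Finset.sum_congr rfl fun b _ => ?_
  congr 1
  change f (Enveloping.ι osp12 b.vec) = g (Enveloping.ι osp12 b.vec)
  rw [ι_vec]
  cases b <;> simp [ospImage, hp, hm]

theorem isOspPair : IsOspPair Ep Em := by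
  rw [isOspPair_iff]
  have h1 := superComm_vec .F .Em
  have h2 := superComm_vec .G .Ep
  simp only [ι_vec, ospImage, OspBasis.parity, OspBasis.table, superSign, ZMod.val_zero, zero_mul,
    pow_zero, one_smul, map_neg, smul_mul_assoc, mul_smul_comm, mul_assoc] at h1 h2
  constructor
  · linear_combination (norm := module) (1 / 2 : ℂ) • h1
  · linear_combination (norm := module) (1 / 2 : ℂ) • h2

theorem ghost_eq : ghost = ghostOf Ep Em := rfl

@[simp]
theorem parity_Ep : Enveloping.parity osp12 Ep = -Ep := by
  rw [Ep, Enveloping.parity_ι, parityMap_of_mem ospGrading (i := 1)]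
  · simp [ZMod.val_one]
  · rw [ospGrading_eq_span]
    exact Submodule.subset_span ⟨_, rfl, rfl⟩

@[simp]
theorem parity_Em : Enveloping.parity osp12 Em = -Em := by
  rw [Em, Enveloping.parity_ι, parityMap_of_mem ospGrading (i := 1)]
  · simp [ZMod.val_one]
  · rw [ospGrading_eq_span]
    exact Submodule.subset_span ⟨_, rfl, rfl⟩

/-- The universal property provides a retraction onto the subalgebra generated by `E₊`, `E₋`. -/
theorem adjoin_eq_top : Algebra.adjoin ℂ ({Ep, Em} : Set UOsp) = ⊤ := by
  set S := Algebra.adjoin ℂ ({Ep, Em} : Set UOsp) with hS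
  have hp : Ep ∈ S := Algebra.subset_adjoin (by simp)
  have hm : Em ∈ S := Algebra.subset_adjoin (by simp)
  have h : IsOspPair (⟨Ep, hp⟩ : S) ⟨Em, hm⟩ :=
    ⟨Subtype.ext isOspPair.left, Subtype.ext isOspPair.right⟩
  have hid : S.val.comp (lift h) = AlgHom.id ℂ UOsp := algHom_ext (by simp) (by simp)
  refine Algebra.eq_top_iff.2 fun u => ?_
  rw [← AlgHom.id_apply (R := ℂ) u, ← hid]
  exact (lift h u).2

theorem Ep_mem : Ep ∈ grading 1 := by
  rw [Enveloping.mem_grading, parity_Ep]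
  simp [ZMod.val_one]

theorem Em_mem : Em ∈ grading 1 := by
  rw [Enveloping.mem_grading, parity_Em]
  simp [ZMod.val_one]

/-- An element that anticommutes with `E₊` and `E₋` implements the parity automorphism. -/
theorem mul_map_of_anticomm (δ : UOsp →ₐ[ℂ] A) {x : A} (hp : δ Ep * x = -(x * δ Ep))
    (hm : δ Em * x = -(x * δ Em)) (u : UOsp) :
    x * δ u = δ (Enveloping.parity osp12 u) * x := by
  have hu : u ∈ Algebra.adjoin ℂ ({Ep, Em} : Set UOsp) :=
    adjoin_eq_top ▸ Algebra.mem_top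
  induction hu using Algebra.adjoin_induction with
  | mem y hy =>
    rcases hy with rfl | rfl
    · rw [parity_Ep, map_neg, neg_mul, hp, neg_neg]
    · rw [parity_Em, map_neg, neg_mul, hm, neg_neg]
  | algebraMap r => simp [Algebra.commutes]
  | add y z _ _ h1 h2 => simp only [map_add, mul_add, add_mul, h1, h2]
  | mul y z _ _ h1 h2 => rw [map_mul, ← mul_assoc, h1, mul_assoc, h2, map_mul, map_mul, mul_assoc]

end UOsp

end Osp

/-! ### The chirality element of a Clifford family -/

section Chirality

variable {A : Type*} [Ring A] [Algebra ℂ A]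

/-- The sign is opposite to that of `mul_prod_ofFn_of_anticomm`, as `g j` commutes with itself. -/
theorem IsCliffordFamily.mul_prod_ofFn {m : ℕ} {g : Fin m → A} (hg : IsCliffordFamily g)
    (j : Fin m) :
    g j * (List.ofFn g).prod = -((-1 : ℂ) ^ m • ((List.ofFn g).prod * g j)) := by
  induction m with
  | zero => exact j.elim0
  | succ m ih =>
    rw [List.ofFn_succ', List.concat_eq_append, List.prod_append, List.prod_singleton]
    induction j using Fin.lastCases with
    | last =>
      rw [← mul_assoc, mul_prod_ofFn_of_anticomm fun j => hg.anticomm (Fin.castSucc_lt_last j).ne',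
        smul_mul_assoc, pow_succ]
      module
    | cast j =>
      rw [← mul_assoc, ih hg.castSucc j, neg_mul, smul_mul_assoc, mul_assoc _ (g j.castSucc),
        hg.anticomm (Fin.castSucc_lt_last j).ne, mul_neg, pow_succ, mul_assoc]
      module

/-- The element `i^n g₁ ⋯ g_m`, meant for `m = 2n` or `m = 2n + 1`: the factor `i^n` then makes it
an involution when `g` is a Clifford family. -/
noncomputable def chirality (n : ℕ) {m : ℕ} (g : Fin m → A) : A :=
  Complex.I ^ n • (List.ofFn g).prod

theorem map_chirality {B : Type*} [Ring B] [Algebra ℂ B] (φ : A →ₐ[ℂ] B) (n : ℕ) {m : ℕ}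
    (g : Fin m → A) : φ (chirality n g) = chirality n fun j => φ (g j) := by
  rw [chirality, chirality, map_smul, map_list_prod, List.map_ofFn]
  rfl

theorem commute_chirality {n m : ℕ} {g : Fin m → A} {x : A} (h : ∀ j, Commute x (g j)) :
    Commute x (chirality n g) := by
  refine Commute.smul_right (Commute.list_prod_right _ _ fun y hy => ?_) _
  obtain ⟨j, rfl⟩ := List.mem_ofFn.1 hy
  exact h j

theorem chirality_succ (n : ℕ) (g : Fin (2 * n + 1) → A) :
    chirality n g = chirality n (fun j : Fin (2 * n) => g j.castSucc) * g (Fin.last _) := by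
  rw [chirality, chirality, List.ofFn_succ', List.concat_eq_append, List.prod_append,
    List.prod_singleton, smul_mul_assoc]

variable {n : ℕ}

theorem commute_chirality_even {g : Fin (2 * n) → A} {x : A} (h : ∀ j, x * g j = -(g j * x)) :
    Commute x (chirality n g) := by
  refine Commute.smul_right ?_ _
  have := mul_prod_ofFn_of_anticomm h
  rwa [pow_mul, neg_one_sq, one_pow, one_smul] at this

theorem anticomm_chirality_odd {g : Fin (2 * n + 1) → A} {x : A}
    (h : ∀ j, x * g j = -(g j * x)) : x * chirality n g = -(chirality n g * x) := by
  have := mul_prod_ofFn_of_anticomm h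
  rw [pow_succ, pow_mul, neg_one_sq, one_pow, one_mul, neg_one_smul] at this
  rw [chirality, mul_smul_comm, this, smul_mul_assoc, smul_neg]

theorem IsCliffordFamily.anticomm_chirality_even {g : Fin (2 * n) → A}
    (hg : IsCliffordFamily g) (j : Fin (2 * n)) :
    g j * chirality n g = -(chirality n g * g j) := by
  have := hg.mul_prod_ofFn j
  rw [pow_mul, neg_one_sq, one_pow, one_smul] at this
  rw [chirality, mul_smul_comm, this, smul_mul_assoc, smul_neg]

theorem IsCliffordFamily.commute_chirality_odd {g : Fin (2 * n + 1) → A}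
    (hg : IsCliffordFamily g) (j : Fin (2 * n + 1)) : Commute (g j) (chirality n g) := by
  refine Commute.smul_right ?_ _
  have := hg.mul_prod_ofFn j
  rwa [pow_succ, pow_mul, neg_one_sq, one_pow, one_mul, neg_one_smul, neg_neg] at this

theorem IsCliffordFamily.chirality_even_sq {g : Fin (2 * n) → A} (hg : IsCliffordFamily g) :
    chirality n g * chirality n g = 1 := by
  rw [chirality, smul_mul_smul_comm, hg.prod_ofFn_even_sq, smul_smul, ← mul_pow, ← mul_pow,
    Complex.I_mul_I, neg_one_mul, neg_neg, one_pow, one_smul]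

theorem IsCliffordFamily.chirality_mul_cancel {g : Fin (2 * n) → A}
    (hg : IsCliffordFamily g) (x : A) :
    chirality n g * (chirality n g * x) = x := by
  rw [← mul_assoc, hg.chirality_even_sq, one_mul]

theorem IsCliffordFamily.chirality_odd_sq {g : Fin (2 * n + 1) → A} (hg : IsCliffordFamily g) :
    chirality n g * chirality n g = 1 := by
  have h : Commute (g (Fin.last _)) (chirality n fun j : Fin (2 * n) => g j.castSucc) :=
    commute_chirality_even fun j => hg.anticomm (Fin.castSucc_lt_last j).ne'
  rw [chirality_succ, h.mul_mul_mul_comm, hg.castSucc.chirality_even_sq, hg.sq, one_mul]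

end Chirality

/-! ### The algebra `𝒜_Λ(n)` by generators and relations -/

section AΛ

variable {A : Type*} [Ring A] [Algebra ℂ A]

theorem commute_ghostOf_of_anticomm {e f x : A} (he : e * x = -(x * e)) (hf : f * x = -(x * f)) :
    Commute x (ghostOf e f) := by
  have h1 : Commute x (e * f) := by
    change x * (e * f) = e * f * x
    rw [mul_assoc, hf, mul_neg, ← mul_assoc e, he, neg_mul, neg_neg, mul_assoc]
  have h2 : Commute x (f * e) := by
    change x * (f * e) = f * e * x
    rw [mul_assoc, he, mul_neg, ← mul_assoc f, hf, neg_mul, neg_neg, mul_assoc]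
  exact (Algebra.commute_algebraMap_right _ _).add_right (h1.sub_right h2)

/-- The data that determine a morphism from `𝒜_Λ(n)` to an algebra: the images of the generators
`ω_j`, `E₊`, `E₋`. The image of `Λ` is then `i^n ω₁ ⋯ ω_{2n+1} θ`, so that the centrality of `Λ`
amounts to the relations of `𝔬𝔰𝔭(1,2)` between `E₊` and `E₋`. -/
structure IsAΛFamily {m : ℕ} (g : Fin m → A) (e f : A) : Prop where
  clifford : IsCliffordFamily g
  osp : IsOspPair e f
  anticomm_left : ∀ j, e * g j = -(g j * e)
  anticomm_right : ∀ j, f * g j = -(g j * f)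

namespace AΛ

variable {n : ℕ}

/-- The images of the generators under the morphism from `𝒜_Λ(n)` defined by `g`, `e`, `f`. -/
noncomputable def image (g : Fin (2 * n + 1) → A) (e f : A) : AGen n → A
  | .ω j => g j
  | .Ep => e
  | .Em => f
  | .Lam => chirality n g * ghostOf e f

/-- The morphism from `𝒜_Λ(n)` that sends the generators to given elements. -/
noncomputable def lift {g : Fin (2 * n + 1) → A} {e f : A} (h : IsAΛFamily g e f) :
    AΛ n →ₐ[ℂ] A :=
  RingQuot.liftAlgHom ℂ ⟨FreeAlgebra.lift ℂ (image g e f), by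
    have hθ : ∀ j, Commute (g j) (ghostOf e f) := fun j =>
      commute_ghostOf_of_anticomm (h.anticomm_left j) (h.anticomm_right j)
    rintro _ _ (x | _ | ⟨j, k⟩ | j | j)
    · simp only [map_mul, FreeAlgebra.lift_ι_apply]
      cases x with
      | ω j => exact (((h.clifford.commute_chirality_odd j).mul_right (hθ j)).eq).symm
      | Ep =>
        have := anticomm_chirality_odd h.anticomm_left
        simp only [image]
        rw [mul_assoc, h.osp.left, mul_neg, ← mul_assoc, ← mul_assoc, this, neg_mul]
      | Em =>
        have := anticomm_chirality_odd h.anticomm_right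
        simp only [image]
        rw [mul_assoc, h.osp.right, mul_neg, ← mul_assoc, ← mul_assoc, this, neg_mul]
      | Lam => rfl
    · have h1 : Commute (ghostOf e f) (chirality n g) := commute_chirality fun j => (hθ j).symm
      simp only [map_sub, map_add, map_mul, map_smul, map_list_prod, List.map_ofFn,
        FreeAlgebra.lift_ι_apply, AlgHom.commutes, Function.comp_def, image]
      rw [← mul_smul_comm, ← chirality, mul_assoc, h1.eq, ← mul_assoc,
        h.clifford.chirality_odd_sq, one_mul, ghostOf, ← add_assoc, ← map_add]
      norm_num
    · have := h.clifford j k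
      simp only [map_add, map_mul, FreeAlgebra.lift_ι_apply, image, this]
      split_ifs
      · exact (map_ofNat (FreeAlgebra.lift ℂ (image g e f)) 2).symm
      · exact (map_zero (FreeAlgebra.lift ℂ (image g e f))).symm
    · simp only [map_neg, map_mul, FreeAlgebra.lift_ι_apply, image, h.anticomm_left]
    · simp only [map_neg, map_mul, FreeAlgebra.lift_ι_apply, image, h.anticomm_right]⟩

theorem lift_gen {g : Fin (2 * n + 1) → A} {e f : A} (h : IsAΛFamily g e f) (x : AGen n) :
    lift h (gen x) = image g e f x := by
  change RingQuot.liftAlgHom ℂ _ (RingQuot.mkAlgHom ℂ _ _) = _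
  rw [RingQuot.liftAlgHom_mkAlgHom_apply, FreeAlgebra.lift_ι_apply]

variable (n) in
/-- The quotient map from the free algebra to `𝒜_Λ(n)`. -/
noncomputable def mk : FreeAlgebra ℂ (AGen n) →ₐ[ℂ] AΛ n := RingQuot.mkAlgHom ℂ (ARel n)

theorem mk_rel {x y : FreeAlgebra ℂ (AGen n)} (h : ARel n x y) : mk n x = mk n y :=
  RingQuot.mkAlgHom_rel ℂ h

theorem isCliffordFamily : IsCliffordFamily fun j => (gen (.ω j) : AΛ n) := by
  intro j k
  have h := mk_rel (.clifford j k)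
  simp only [map_add, map_mul] at h
  refine h.trans ?_
  split_ifs
  · exact map_ofNat (mk n) 2
  · exact map_zero (mk n)

theorem commute_Lam_gen (x : AGen n) : Commute (gen .Lam : AΛ n) (gen x) := by
  have h := mk_rel (.central x)
  simp only [map_mul] at h
  exact h

/-- The relation for `E₊ E₋ - E₋ E₊`, read as a formula for the ghost. -/
theorem ghostOf_eq : ghostOf (gen .Ep) (gen .Em) =
    (gen .Lam * chirality n fun j => gen (.ω j) : AΛ n) := by
  have h := mk_rel (ARel.comm (n := n))
  simp only [map_sub, map_add, map_mul, map_smul, map_list_prod, List.map_ofFn,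
    AlgHom.commutes] at h
  change gen .Ep * gen .Em - gen .Em * gen .Ep = algebraMap ℂ (AΛ n) _ +
    Complex.I ^ n • (gen .Lam * (List.ofFn fun j => gen (.ω j)).prod) at h
  rw [ghostOf, h, ← add_assoc, ← map_add, chirality, mul_smul_comm]
  norm_num

theorem Ep_mul_ω (j : Fin (2 * n + 1)) :
    (gen .Ep * gen (.ω j) : AΛ n) = -(gen (.ω j) * gen .Ep) := by
  have h := mk_rel (.anticommEp j)
  simp only [map_mul, map_neg] at h
  exact h

theorem Em_mul_ω (j : Fin (2 * n + 1)) :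
    (gen .Em * gen (.ω j) : AΛ n) = -(gen (.ω j) * gen .Em) := by
  have h := mk_rel (.anticommEm j)
  simp only [map_mul, map_neg] at h
  exact h

theorem isAΛFamily : IsAΛFamily (fun j => (gen (.ω j) : AΛ n)) (gen .Ep) (gen .Em) where
  clifford := isCliffordFamily
  osp := by
    constructor
    · rw [ghostOf_eq, ← mul_assoc, ← (commute_Lam_gen _).eq, mul_assoc, mul_assoc,
        anticomm_chirality_odd Ep_mul_ω, mul_neg, neg_neg]
    · rw [ghostOf_eq, ← mul_assoc, ← (commute_Lam_gen _).eq, mul_assoc, mul_assoc,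
        anticomm_chirality_odd Em_mul_ω, mul_neg, neg_neg]
  anticomm_left := Ep_mul_ω
  anticomm_right := Em_mul_ω

theorem Lam_eq : (gen .Lam : AΛ n) =
    ghostOf (gen .Ep) (gen .Em) * chirality n fun j => gen (.ω j) := by
  rw [ghostOf_eq, mul_assoc, isCliffordFamily.chirality_odd_sq, mul_one]

/-- The generator `Λ` is redundant, by `AΛ.Lam_eq`. -/
theorem algHom_ext {φ ψ : AΛ n →ₐ[ℂ] A} (hω : ∀ j, φ (gen (.ω j)) = ψ (gen (.ω j)))
    (hp : φ (gen .Ep) = ψ (gen .Ep)) (hm : φ (gen .Em) = ψ (gen .Em)) : φ = ψ := by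
  refine RingQuot.ringQuot_ext' _ _ _ (FreeAlgebra.hom_ext (funext fun x => ?_))
  change φ (gen x) = ψ (gen x)
  cases x with
  | ω j => exact hω j
  | Ep => exact hp
  | Em => exact hm
  | Lam =>
    rw [Lam_eq, map_mul, map_mul, map_ghostOf, map_ghostOf, map_chirality, map_chirality, hp, hm]
    simp only [hω]

theorem adjoin_gen : Algebra.adjoin ℂ (Set.range (gen : AGen n → AΛ n)) = ⊤ := by
  have h := FreeAlgebra.adjoin_range_ι (R := ℂ) (X := AGen n)
  replace h := congrArg (Subalgebra.map (mk n)) h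
  rw [AlgHom.map_adjoin, ← Set.range_comp, Algebra.map_top,
    (AlgHom.range_eq_top (mk n)).2 (RingQuot.mkAlgHom_surjective ℂ (ARel n))] at h
  exact h

theorem Lam_mem_center : (gen .Lam : AΛ n) ∈ Subalgebra.center ℂ (AΛ n) := by
  rw [Subalgebra.mem_center_iff]
  intro b
  refine (Algebra.commute_of_mem_adjoin_of_forall_mem_commute
    (adjoin_gen ▸ Algebra.mem_top : b ∈ Algebra.adjoin ℂ (Set.range gen)) ?_).symm
  rintro _ ⟨x, rfl⟩
  exact commute_Lam_gen x

end AΛ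

end AΛ

/-! ### The isomorphism of `𝒜_Λ(n)` with a graded tensor product -/

section GradedTensor

variable {A : Type*} [Ring A] [Algebra ℂ A]

open LieSuperalgebra

/-- If `E₊` and `E₋` anticommute with the generators of the Clifford algebra, then the
enveloping algebra and the Clifford algebra supercommute. -/
theorem supercommute {m : ℕ} (γ : Cl m →ₐ[ℂ] A) (δ : UOsp →ₐ[ℂ] A)
    (hp : ∀ j, δ UOsp.Ep * γ (Cl.ω j) = -(γ (Cl.ω j) * δ UOsp.Ep))
    (hm : ∀ j, δ UOsp.Em * γ (Cl.ω j) = -(γ (Cl.ω j) * δ UOsp.Em)) ⦃i j : ZMod 2⦄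
    (a : Cl.grading m i) (b : UOsp.grading j) :
    γ a * δ b = (-1 : ℤˣ) ^ (j * i) • (δ b * γ a) := by
  have hv : ∀ v u, γ (CliffordAlgebra.ι _ v) * δ u =
      δ (Enveloping.parity osp12 u) * γ (CliffordAlgebra.ι _ v) := by
    intro v u
    simp only [Cl.ι_eq_sum, map_sum, map_smul, Finset.sum_mul, Finset.mul_sum, smul_mul_assoc,
      mul_smul_comm, UOsp.mul_map_of_anticomm δ (hp _) (hm _)]
  have hvv : ∀ v w u, γ (CliffordAlgebra.ι _ v * CliffordAlgebra.ι _ w) * δ u =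
      δ u * γ (CliffordAlgebra.ι _ v * CliffordAlgebra.ι _ w) := by
    intro v w u
    rw [map_mul, mul_assoc, hv, ← mul_assoc, hv, Enveloping.parity_parity, mul_assoc]
  obtain ⟨a, ha⟩ := a
  obtain ⟨b, hb⟩ := b
  change γ a * δ b = (-1 : ℤˣ) ^ (j * i) • (δ b * γ a)
  have hi := zmodTwo_cases i
  rcases hi with rfl | rfl
  · rw [mul_zero, uzpow_zero, one_smul]
    clear hb
    induction a, ha using CliffordAlgebra.even_induction with
    | algebraMap r => simp [Algebra.commutes]
    | add x y _ _ h1 h2 => rw [map_add, add_mul, h1, h2, mul_add]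
    | ι_mul_ι_mul v w x _ h => rw [map_mul, mul_assoc, h, ← mul_assoc, hvv, mul_assoc]
  · have h : γ a * δ b = δ (Enveloping.parity osp12 b) * γ a := by
      clear hb
      induction a, ha using CliffordAlgebra.odd_induction with
      | ι v => exact hv v b
      | add x y _ _ h1 h2 => rw [map_add, add_mul, h1, h2, mul_add]
      | ι_mul_ι_mul v w x _ h => rw [map_mul, mul_assoc, h, ← mul_assoc, hvv, mul_assoc]
    rw [h, (Enveloping.mem_grading osp12).1 hb, mul_one]
    have hj := zmodTwo_cases j
    rcases hj with rfl | rfl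
    · simp
    · simp [ZMod.val_one]

theorem Cl.ω_mem {m : ℕ} (j : Fin m) : (ω j : Cl m) ∈ grading m 1 :=
  CliffordAlgebra.ι_mem_evenOdd_one _ _

open GradedTensorProduct

theorem includeRight_mul_includeLeft_ω {m : ℕ} (j : Fin m) {u : UOsp}
    (hu : u ∈ UOsp.grading 1) :
    includeRight (Cl.grading m) UOsp.grading u * includeLeft (Cl.grading m) UOsp.grading (Cl.ω j) =
      -(includeLeft (Cl.grading m) UOsp.grading (Cl.ω j) *
        includeRight (Cl.grading m) UOsp.grading u) := by
  have h := tmul_coe_mul_coe_tmul (R := ℂ) (Cl.grading m) UOsp.grading 1 ⟨u, hu⟩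
    ⟨Cl.ω j, Cl.ω_mem j⟩ 1
  simp only [one_mul, mul_one, uzpow_one, Units.neg_smul, one_smul] at h
  rw [includeLeft_apply, includeRight_apply, h, tmul_one_mul_one_tmul]

theorem isAΛFamily_gradedTensor (m : ℕ) :
    IsAΛFamily (fun j : Fin m => includeLeft (Cl.grading m) UOsp.grading (Cl.ω j))
      (includeRight (Cl.grading m) UOsp.grading UOsp.Ep)
      (includeRight (Cl.grading m) UOsp.grading UOsp.Em) where
  clifford := isCliffordFamily_ω.map _
  osp := UOsp.isOspPair.map _
  anticomm_left j := includeRight_mul_includeLeft_ω j UOsp.Ep_mem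
  anticomm_right j := includeRight_mul_includeLeft_ω j UOsp.Em_mem

namespace AΛ

/-- The isomorphism of `𝒜_Λ(n)` with the graded tensor product of `𝒞(2n+1)` and `𝒰`. -/
noncomputable def gradedTensorEquiv (n : ℕ) :
    AΛ n ≃ₐ[ℂ] (Cl.grading (2 * n + 1) ᵍ⊗[ℂ] UOsp.grading) :=
  AlgEquiv.ofAlgHom (lift (isAΛFamily_gradedTensor (2 * n + 1)))
    (GradedTensorProduct.lift _ _ (Cl.lift isCliffordFamily) (UOsp.lift isAΛFamily.osp)
      (supercommute _ _ (by simpa using Ep_mul_ω) (by simpa using Em_mul_ω)))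
    (by
      refine GradedTensorProduct.algHom_ext _ _ (Cl.algHom_ext fun j => ?_)
        (UOsp.algHom_ext ?_ ?_) <;>
      simp [lift_gen, image])
    (by refine algHom_ext (fun j => ?_) ?_ ?_ <;> simp [lift_gen, image])

theorem gradedTensorEquiv_gen (n : ℕ) (x : AGen n) :
    gradedTensorEquiv n (gen x) =
      image (fun j => Cl.ω j ᵍ⊗ₜ[ℂ] (1 : UOsp)) ((1 : Cl (2 * n + 1)) ᵍ⊗ₜ[ℂ] UOsp.Ep)
        ((1 : Cl (2 * n + 1)) ᵍ⊗ₜ[ℂ] UOsp.Em) x :=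
  lift_gen _ x

theorem gradedTensorEquiv_Lam (n : ℕ) :
    gradedTensorEquiv n (gen .Lam) =
      (Complex.I ^ n • Cl.volume (2 * n + 1)) ᵍ⊗ₜ[ℂ] UOsp.ghost := by
  rw [← tmul_one_mul_one_tmul, UOsp.ghost_eq]
  refine (gradedTensorEquiv_gen n _).trans ?_
  change chirality n (fun j => includeLeft (Cl.grading (2 * n + 1)) UOsp.grading (Cl.ω j)) *
    ghostOf (includeRight (Cl.grading (2 * n + 1)) UOsp.grading UOsp.Ep)
      (includeRight (Cl.grading (2 * n + 1)) UOsp.grading UOsp.Em) = _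
  rw [← map_chirality, ← map_ghostOf]
  rfl

end AΛ

end GradedTensor

/-! ### The smash product -/

section Smash

variable {A : Type*} [Ring A] [Algebra ℂ A]

/-- Multiplying `e` and `f` by an involution that commutes with them does not change their ghost. -/
theorem ghostOf_mul {e f v : A} (hv : v * v = 1) (he : Commute v e) (hf : Commute v f) :
    ghostOf (v * e) (v * f) = ghostOf e f := by
  rw [ghostOf, he.symm.mul_mul_mul_comm, hf.symm.mul_mul_mul_comm, hv, one_mul, one_mul, ghostOf]

theorem IsOspPair.mul {e f v : A} (h : IsOspPair e f) (hv : v * v = 1) (he : Commute v e)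
    (hf : Commute v f) : IsOspPair (v * e) (v * f) := by
  have hθ : Commute v (ghostOf e f) :=
    (Algebra.commute_algebraMap_right _ _).add_right
      ((he.mul_right hf).sub_right (hf.mul_right he))
  constructor
  · rw [ghostOf_mul hv he hf, ← mul_assoc, ← hθ.eq, mul_assoc, h.left, mul_neg, mul_assoc]
  · rw [ghostOf_mul hv he hf, ← mul_assoc, ← hθ.eq, mul_assoc, h.right, mul_neg, mul_assoc]

/-- The data that determine a morphism from `𝔖₂ ⋉ 𝒰` to an algebra: the images of the non-trivial
permutation and of `E₊`, `E₋`. -/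
structure IsSmashTriple (s e f : A) : Prop where
  sq : s * s = 1
  osp : IsOspPair e f
  anticomm_left : s * e = -(e * s)
  anticomm_right : s * f = -(f * s)

theorem IsSmashTriple.map {B : Type*} [Ring B] [Algebra ℂ B] {s e f : A}
    (h : IsSmashTriple s e f) (φ : A →ₐ[ℂ] B) : IsSmashTriple (φ s) (φ e) (φ f) where
  sq := by rw [← map_mul, h.sq, map_one]
  osp := h.osp.map φ
  anticomm_left := by rw [← map_mul, h.anticomm_left, map_neg, map_mul]
  anticomm_right := by rw [← map_mul, h.anticomm_right, map_neg, map_mul]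

namespace UOsp.Smash

open SkewMonoidAlgebra

/-- The inclusion of `𝒰` in `𝔖₂ ⋉ 𝒰`. -/
noncomputable def incl : UOsp →ₐ[ℂ] Smash :=
  { singleOneRingHom with commutes' := fun _ => rfl }

/-- The element `1 ⊗ s` of `𝔖₂ ⋉ 𝒰`, for `s` the non-trivial permutation. -/
noncomputable def swap : Smash := single (Equiv.swap 0 1) 1

theorem single_one (u : UOsp) : single (1 : Equiv.Perm (Fin 2)) u = incl u := rfl

theorem single_swap (u : UOsp) :
    single (Equiv.swap 0 1 : Equiv.Perm (Fin 2)) u = incl u * swap := by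
  rw [← single_one, swap, single_mul_single, one_smul, one_mul, mul_one]

theorem swap_mul_swap : swap * swap = 1 := by
  rw [swap, single_mul_single, smul_one, one_mul, Equiv.swap_mul_self, one_def]

theorem swap_mul_incl (u : UOsp) :
    swap * incl u = incl (LieSuperalgebra.Enveloping.parity osp12 u) * swap := by
  rw [← single_one, ← single_swap, swap, single_mul_single, one_mul, mul_one,
    LieSuperalgebra.Enveloping.perm_smul_def, if_neg (by decide)]

theorem isSmashTriple : IsSmashTriple swap (incl Ep) (incl Em) where
  sq := swap_mul_swap
  osp := isOspPair.map incl
  anticomm_left := by rw [swap_mul_incl, parity_Ep, map_neg, neg_mul]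
  anticomm_right := by rw [swap_mul_incl, parity_Em, map_neg, neg_mul]

/-- The morphism from `𝔖₂` that sends the non-trivial permutation to a given involution. -/
def permHom {s : A} (hs : s * s = 1) : Equiv.Perm (Fin 2) →* A where
  toFun g := if g = 1 then 1 else s
  map_one' := if_pos rfl
  map_mul' g h := by
    have key : ∀ g h : Equiv.Perm (Fin 2), g ≠ 1 → h ≠ 1 → g * h = 1 := by decide
    by_cases hg : g = 1
    · simp [hg]
    · by_cases hh : h = 1
      · simp [hh]
      · simp [hg, hh, key g h hg hh, hs]

/-- The universal property of `𝔖₂ ⋉ 𝒰` by generators and relations. -/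
noncomputable def lift {s e f : A} (h : IsSmashTriple s e f) : Smash →ₐ[ℂ] A :=
  liftNCAlgHom (UOsp.lift h.osp) (permHom h.sq) (by
    intro u g
    rw [LieSuperalgebra.Enveloping.perm_smul_def]
    change _ * (if g = 1 then 1 else s) = (if g = 1 then 1 else s) * _
    split_ifs with hg
    · rw [mul_one, one_mul]
    · exact (mul_map_of_anticomm _ (by simp [h.anticomm_left])
        (by simp [h.anticomm_right]) u).symm)

theorem lift_single {s e f : A} (h : IsSmashTriple s e f) (g : Equiv.Perm (Fin 2)) (u : UOsp) :
    lift h (single g u) = UOsp.lift h.osp u * permHom h.sq g :=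
  liftNC_single _ _ _ _

@[simp]
theorem lift_incl {s e f : A} (h : IsSmashTriple s e f) (u : UOsp) :
    lift h (incl u) = UOsp.lift h.osp u := by
  rw [← single_one, lift_single, map_one, mul_one]

@[simp]
theorem lift_swap {s e f : A} (h : IsSmashTriple s e f) : lift h swap = s := by
  rw [swap, lift_single, map_one, one_mul]
  change (if (Equiv.swap 0 1 : Equiv.Perm (Fin 2)) = 1 then (1 : A) else s) = s
  exact if_neg (by decide)

theorem algHom_ext {φ ψ : Smash →ₐ[ℂ] A} (hs : φ swap = ψ swap) (hp : φ (incl Ep) = ψ (incl Ep))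
    (hm : φ (incl Em) = ψ (incl Em)) : φ = ψ := by
  have h : φ.comp incl = ψ.comp incl := UOsp.algHom_ext hp hm
  have hu : ∀ u, φ (incl u) = ψ (incl u) := DFunLike.congr_fun h
  refine AlgHom.toLinearMap_injective (lhom_ext fun g u => ?_)
  change φ (single g u) = ψ (single g u)
  have hg : g = 1 ∨ g = Equiv.swap 0 1 := by revert g; decide
  rcases hg with rfl | rfl
  · exact hu u
  · rw [single_swap, map_mul, map_mul, hu, hs]

theorem adjoin_eq_top : Algebra.adjoin ℂ ({swap, incl Ep, incl Em} : Set Smash) = ⊤ := by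
  set S := Algebra.adjoin ℂ ({swap, incl Ep, incl Em} : Set Smash) with hS
  have hs : swap ∈ S := Algebra.subset_adjoin (by simp)
  have hp : incl Ep ∈ S := Algebra.subset_adjoin (by simp)
  have hm : incl Em ∈ S := Algebra.subset_adjoin (by simp)
  have h : IsSmashTriple (⟨swap, hs⟩ : S) ⟨incl Ep, hp⟩ ⟨incl Em, hm⟩ :=
    ⟨Subtype.ext isSmashTriple.sq,
      ⟨Subtype.ext isSmashTriple.osp.left, Subtype.ext isSmashTriple.osp.right⟩,
      Subtype.ext isSmashTriple.anticomm_left, Subtype.ext isSmashTriple.anticomm_right⟩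
  have hid : S.val.comp (lift h) = AlgHom.id ℂ Smash :=
    algHom_ext (by simp) (by simp) (by simp)
  refine Algebra.eq_top_iff.2 fun u => ?_
  rw [← AlgHom.id_apply (R := ℂ) u, ← hid]
  exact (lift h u).2

end UOsp.Smash

/-- Algebra morphisms commute if they commute on generators. -/
theorem commute_of_adjoin_eq_top {B C : Type*} [Ring B] [Algebra ℂ B] [Ring C] [Algebra ℂ C]
    {s : Set B} {t : Set C} (hs : Algebra.adjoin ℂ s = ⊤) (ht : Algebra.adjoin ℂ t = ⊤)
    (φ : B →ₐ[ℂ] A) (ψ : C →ₐ[ℂ] A) (h : ∀ x ∈ s, ∀ y ∈ t, Commute (φ x) (ψ y)) (b : B) (c : C) :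
    Commute (φ b) (ψ c) := by
  have hφ : φ b ∈ Algebra.adjoin ℂ (φ '' s) := by
    rw [← AlgHom.map_adjoin, hs]
    exact ⟨b, Algebra.mem_top, rfl⟩
  have hψ : ψ c ∈ Algebra.adjoin ℂ (ψ '' t) := by
    rw [← AlgHom.map_adjoin, ht]
    exact ⟨c, Algebra.mem_top, rfl⟩
  refine Algebra.commute_of_mem_adjoin_of_forall_mem_commute hψ ?_
  rintro _ ⟨y, hy, rfl⟩
  refine (Algebra.commute_of_mem_adjoin_of_forall_mem_commute hφ ?_).symm
  rintro _ ⟨x, hx, rfl⟩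
  exact (h x hx y hy).symm

/-! ### The isomorphism of `𝒜_Λ(n)` with an ordinary tensor product -/

variable {n : ℕ}

/-- The product with the chirality element of `𝒞(2n)` turns elements that commute with
`ω₁, …, ω_{2n}` into elements that anticommute with them. The involution `s` then provides the last
generator `ω_{2n+1}`. -/
theorem IsSmashTriple.isAΛFamily {g : Fin (2 * n) → A} {s e f : A} (hg : IsCliffordFamily g)
    (h : IsSmashTriple s e f) (hs : ∀ j, Commute (g j) s) (he : ∀ j, Commute (g j) e)
    (hf : ∀ j, Commute (g j) f) :
    IsAΛFamily (Fin.snoc g (chirality n g * s) : Fin (2 * n + 1) → A) (chirality n g * e)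
      (chirality n g * f) := by
  have ks : Commute s (chirality n g) := commute_chirality fun j => (hs j).symm
  have ke : Commute e (chirality n g) := commute_chirality fun j => (he j).symm
  have kf : Commute f (chirality n g) := commute_chirality fun j => (hf j).symm
  have hv := hg.chirality_even_sq
  have anti : ∀ {x : A}, (∀ j, Commute (g j) x) → Commute x (chirality n g) → s * x = -(x * s) →
      ∀ j, chirality n g * x * (Fin.snoc g (chirality n g * s) : Fin (2 * n + 1) → A) j =
        -((Fin.snoc g (chirality n g * s) : Fin (2 * n + 1) → A) j * (chirality n g * x)) := by
    intro x hx kx hsx j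
    induction j using Fin.lastCases with
    | last =>
      rw [Fin.snoc_last, kx.mul_mul_mul_comm, ks.mul_mul_mul_comm, hv, hsx, one_mul, one_mul,
        neg_neg]
    | cast j =>
      rw [Fin.snoc_castSucc, ← mul_assoc, hg.anticomm_chirality_even, neg_mul, neg_neg, mul_assoc,
        mul_assoc, (hx j).eq]
  refine ⟨hg.snoc ?_ fun j => ?_, h.osp.mul hv ke.symm kf.symm, anti he ke h.anticomm_left,
    anti hf kf h.anticomm_right⟩
  · rw [ks.mul_mul_mul_comm, hv, h.sq, one_mul]
  · rw [← mul_assoc, hg.anticomm_chirality_even, neg_mul, mul_assoc, (hs j).eq, mul_assoc]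

theorem IsCliffordFamily.commute_chirality_mul {g : Fin (2 * n + 1) → A} {x : A}
    (hg : IsCliffordFamily g) (hx : ∀ j, x * g j = -(g j * x)) (j : Fin (2 * n)) :
    Commute (g j.castSucc) (chirality n (fun j : Fin (2 * n) => g j.castSucc) * x) := by
  change _ = _
  rw [← mul_assoc, hg.castSucc.anticomm_chirality_even, mul_assoc _ x, hx, neg_mul, mul_neg,
    mul_assoc]

/-- The converse of `IsSmashTriple.isAΛFamily`: since the chirality element is an involution, the
same product recovers the generators of `𝔖₂ ⋉ 𝒰`. -/
theorem IsAΛFamily.isSmashTriple {g : Fin (2 * n + 1) → A} {e f : A} (h : IsAΛFamily g e f) :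
    IsSmashTriple (chirality n (fun j : Fin (2 * n) => g j.castSucc) * g (Fin.last _))
      (chirality n (fun j : Fin (2 * n) => g j.castSucc) * e)
      (chirality n (fun j : Fin (2 * n) => g j.castSucc) * f) := by
  have hv := h.clifford.castSucc.chirality_even_sq
  have kl : Commute (g (Fin.last _)) (chirality n fun j : Fin (2 * n) => g j.castSucc) :=
    commute_chirality_even fun j => h.clifford.anticomm (Fin.castSucc_lt_last j).ne'
  have ke : Commute e (chirality n fun j : Fin (2 * n) => g j.castSucc) :=
    commute_chirality_even fun j => h.anticomm_left j.castSucc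
  have kf : Commute f (chirality n fun j : Fin (2 * n) => g j.castSucc) :=
    commute_chirality_even fun j => h.anticomm_right j.castSucc
  constructor
  · rw [kl.mul_mul_mul_comm, hv, h.clifford.sq, one_mul]
  · exact h.osp.mul hv ke.symm kf.symm
  · rw [kl.mul_mul_mul_comm, ke.mul_mul_mul_comm, hv, h.anticomm_left, one_mul, one_mul, neg_neg]
  · rw [kl.mul_mul_mul_comm, kf.mul_mul_mul_comm, hv, h.anticomm_right, one_mul, one_mul, neg_neg]

open Algebra.TensorProduct in
theorem isAΛFamily_tensor (n : ℕ) :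
    IsAΛFamily (A := Cl (2 * n) ⊗[ℂ] UOsp.Smash)
      (Fin.snoc (fun j => includeLeft (S := ℂ) (Cl.ω j))
        (chirality n (fun j => includeLeft (S := ℂ) (Cl.ω j)) * includeRight UOsp.Smash.swap) :
        Fin (2 * n + 1) → Cl (2 * n) ⊗[ℂ] UOsp.Smash)
      (chirality n (fun j => includeLeft (S := ℂ) (Cl.ω j)) *
        includeRight (UOsp.Smash.incl UOsp.Ep))
      (chirality n (fun j => includeLeft (S := ℂ) (Cl.ω j)) *
        includeRight (UOsp.Smash.incl UOsp.Em)) := by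
  have hc : ∀ (a : Cl (2 * n)) (b : UOsp.Smash), Commute
      (includeLeft (S := ℂ) a : Cl (2 * n) ⊗[ℂ] UOsp.Smash) (includeRight b) := by
    intro a b
    simp [Commute, SemiconjBy]
  exact IsSmashTriple.isAΛFamily (isCliffordFamily_ω.map _)
    (UOsp.Smash.isSmashTriple.map
      (includeRight : UOsp.Smash →ₐ[ℂ] Cl (2 * n) ⊗[ℂ] UOsp.Smash))
    (fun j => hc _ _) (fun j => hc _ _) fun j => hc _ _

namespace AΛ

/-- The morphism from `𝒞(2n) ⊗ (𝔖₂ ⋉ 𝒰)` to `𝒜_Λ(n)` that sends `ω_j` to `ω_j`, the non-trivial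
permutation to `Γ ω_{2n+1}` and `E₊`, `E₋` to `Γ E₊`, `Γ E₋`, where `Γ` is the chirality element
`i^n ω₁ ⋯ ω_{2n}`. -/
noncomputable def ofTensor (n : ℕ) : (Cl (2 * n) ⊗[ℂ] UOsp.Smash) →ₐ[ℂ] AΛ n :=
  Algebra.TensorProduct.lift (Cl.lift isCliffordFamily.castSucc)
    (UOsp.Smash.lift isAΛFamily.isSmashTriple) (by
      refine commute_of_adjoin_eq_top (Cl.adjoin_eq_top _) UOsp.Smash.adjoin_eq_top _ _ ?_
      rintro _ ⟨j, rfl⟩ _ (rfl | rfl | rfl)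
      · rw [Cl.lift_ω, UOsp.Smash.lift_swap]
        have h := isCliffordFamily.commute_chirality_odd (n := n) j.castSucc
        rw [chirality_succ] at h
        exact h
      · rw [Cl.lift_ω, UOsp.Smash.lift_incl, UOsp.lift_Ep]
        exact isCliffordFamily.commute_chirality_mul Ep_mul_ω j
      · rw [Cl.lift_ω, UOsp.Smash.lift_incl, UOsp.lift_Em]
        exact isCliffordFamily.commute_chirality_mul Em_mul_ω j)

theorem ofTensor_includeLeft_ω (j : Fin (2 * n)) :
    ofTensor n (Algebra.TensorProduct.includeLeft (S := ℂ) (Cl.ω j)) = gen (.ω j.castSucc) := by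
  simp [ofTensor]

theorem ofTensor_includeRight (x : UOsp.Smash) :
    ofTensor n (Algebra.TensorProduct.includeRight x) =
      UOsp.Smash.lift isAΛFamily.isSmashTriple x := by
  simp [ofTensor]

/-- The isomorphism of `𝒜_Λ(n)` with the tensor product of `𝒞(2n)` and `𝔖₂ ⋉ 𝒰`. -/
noncomputable def tensorEquiv (n : ℕ) : AΛ n ≃ₐ[ℂ] (Cl (2 * n) ⊗[ℂ] UOsp.Smash) :=
  AlgEquiv.ofAlgHom (lift (isAΛFamily_tensor n)) (ofTensor n)
    (by
      have hl : ∀ j : Fin (2 * n), lift (isAΛFamily_tensor n) (gen (.ω j.castSucc)) =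
          Algebra.TensorProduct.includeLeft (S := ℂ) (Cl.ω j) := by
        intro j
        rw [lift_gen]
        simp only [image, Fin.snoc_castSucc]
      refine Algebra.TensorProduct.ext (Cl.algHom_ext fun j => ?_)
        (UOsp.Smash.algHom_ext ?_ ?_ ?_)
      · simp only [AlgHom.comp_apply, ofTensor_includeLeft_ω, hl, AlgHom.id_apply]
      all_goals
        change lift (isAΛFamily_tensor n) (ofTensor n (Algebra.TensorProduct.includeRight _)) =
          Algebra.TensorProduct.includeRight _
        simp only [ofTensor_includeRight, UOsp.Smash.lift_swap, UOsp.Smash.lift_incl,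
          UOsp.lift_Ep, UOsp.lift_Em, map_mul, map_chirality, hl]
        rw [lift_gen]
        simp only [image, Fin.snoc_last]
        exact (isCliffordFamily_ω.map _).chirality_mul_cancel _)
    (by
      refine algHom_ext (fun j => ?_) ?_ ?_
      · rw [AlgHom.comp_apply, lift_gen]
        simp only [image]
        induction j using Fin.lastCases with
        | last =>
          simp only [Fin.snoc_last, map_mul, map_chirality, ofTensor_includeLeft_ω,
            ofTensor_includeRight, UOsp.Smash.lift_swap]
          exact isCliffordFamily.castSucc.chirality_mul_cancel _
        | cast j =>
          rw [Fin.snoc_castSucc, ofTensor_includeLeft_ω]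
          rfl
      all_goals
        rw [AlgHom.comp_apply, lift_gen]
        simp only [image, map_mul, map_chirality, ofTensor_includeLeft_ω, ofTensor_includeRight,
          UOsp.Smash.lift_incl, UOsp.lift_Ep, UOsp.lift_Em]
        exact isCliffordFamily.castSucc.chirality_mul_cancel _)

end AΛ

end Smash

/-! ### Even Clifford algebras are matrix algebras -/

section Matrix

variable {A : Type*} [Ring A] [Algebra ℂ A]

/-- The Pauli matrix `σ_x`. -/
def pauliX : Matrix (Fin 2) (Fin 2) ℂ := !![0, 1; 1, 0]

/-- The Pauli matrix `σ_y`. -/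
def pauliY : Matrix (Fin 2) (Fin 2) ℂ := !![0, -Complex.I; Complex.I, 0]

/-- The Pauli matrix `σ_z = -i σ_x σ_y`. -/
def pauliZ : Matrix (Fin 2) (Fin 2) ℂ := !![1, 0; 0, -1]

theorem pauliX_sq : pauliX * pauliX = 1 := by
  simp [pauliX, Matrix.one_fin_two]

theorem pauliY_sq : pauliY * pauliY = 1 := by
  simp [pauliY, Matrix.one_fin_two]

theorem pauliZ_sq : pauliZ * pauliZ = 1 := by
  simp [pauliZ, Matrix.one_fin_two]

theorem pauliX_mul_pauliY : pauliX * pauliY = -(pauliY * pauliX) := by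
  simp [pauliX, pauliY]

theorem pauliZ_mul_pauliX : pauliZ * pauliX = -(pauliX * pauliZ) := by
  simp [pauliX, pauliZ]

theorem pauliZ_mul_pauliY : pauliZ * pauliY = -(pauliY * pauliZ) := by
  simp [pauliY, pauliZ]

theorem pauliZ_eq : pauliZ = -Complex.I • (pauliX * pauliY) := by
  simp [pauliX, pauliY, pauliZ]

/-- The linear map from the `2 × 2` matrices to an algebra that sends the basis
`1, σ_x, σ_y, σ_x σ_y` to `1, p, q, p q`, in terms of the matrix entries. -/
noncomputable def ofPauli (p q : A) : Matrix (Fin 2) (Fin 2) ℂ →ₗ[ℂ] A where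
  toFun M := ((M 0 0 + M 1 1) / 2) • (1 : A) + ((M 0 1 + M 1 0) / 2) • p +
    (Complex.I * (M 0 1 - M 1 0) / 2) • q - (Complex.I * (M 0 0 - M 1 1) / 2) • (p * q)
  map_add' M N := by
    simp only [Matrix.add_apply]
    module
  map_smul' c M := by
    simp only [Matrix.smul_apply, smul_eq_mul, RingHom.id_apply]
    module

theorem ofPauli_apply (p q : A) (M : Matrix (Fin 2) (Fin 2) ℂ) :
    ofPauli p q M = ((M 0 0 + M 1 1) / 2) • (1 : A) + ((M 0 1 + M 1 0) / 2) • p +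
      (Complex.I * (M 0 1 - M 1 0) / 2) • q - (Complex.I * (M 0 0 - M 1 1) / 2) • (p * q) := rfl

theorem ofPauli_pauli (M : Matrix (Fin 2) (Fin 2) ℂ) : ofPauli pauliX pauliY M = M := by
  have h := Complex.I_mul_I
  rw [ofPauli_apply]
  ext i j
  fin_cases i <;> fin_cases j <;> simp [pauliX, pauliY]
  · linear_combination (-(M 0 0 - M 1 1) / 2) * h
  · linear_combination (-(M 0 1 - M 1 0) / 2) * h
  · linear_combination ((M 0 1 - M 1 0) / 2) * h
  · linear_combination ((M 0 0 - M 1 1) / 2) * h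

theorem map_ofPauli {B : Type*} [Ring B] [Algebra ℂ B] (φ : A →ₐ[ℂ] B) (p q : A)
    (M : Matrix (Fin 2) (Fin 2) ℂ) : φ (ofPauli p q M) = ofPauli (φ p) (φ q) M := by
  simp only [ofPauli_apply, map_add, map_sub, map_smul, map_mul, map_one]

/-- Two anticommuting elements of square one define a morphism from the algebra of `2 × 2`
matrices. -/
noncomputable def pauliLift {p q : A} (hp : p * p = 1) (hq : q * q = 1) (hpq : q * p = -(p * q)) :
    Matrix (Fin 2) (Fin 2) ℂ →ₐ[ℂ] A :=
  AlgHom.ofLinearMap (ofPauli p q)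
    (by simp [ofPauli_apply])
    (by
      have hp' : ∀ x, p * (p * x) = x := fun x => by rw [← mul_assoc, hp, one_mul]
      have hqp' : ∀ x, q * (p * x) = -(p * (q * x)) := fun x => by
        rw [← mul_assoc, hpq, neg_mul, mul_assoc]
      intro M N
      simp only [ofPauli_apply, Matrix.mul_apply, Fin.sum_univ_two, add_mul, mul_add, sub_mul,
        mul_sub, smul_mul_assoc, mul_smul_comm, one_mul, mul_one, mul_assoc, hp, hq, hpq, hp',
        hqp', mul_neg]
      have h := Complex.I_sq
      match_scalars <;> grind)

@[simp]
theorem pauliLift_apply {p q : A} (hp : p * p = 1) (hq : q * q = 1) (hpq : q * p = -(p * q))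
    (M : Matrix (Fin 2) (Fin 2) ℂ) : pauliLift hp hq hpq M = ofPauli p q M := rfl

theorem ofPauli_pauliX (p q : A) : ofPauli p q pauliX = p := by
  simp [ofPauli_apply, pauliX]

theorem ofPauli_pauliY (p q : A) : ofPauli p q pauliY = q := by
  have h : Complex.I * (-Complex.I - Complex.I) / 2 = 1 := by
    linear_combination -Complex.I_mul_I
  simp [ofPauli_apply, pauliY, h]

theorem ofPauli_pauliZ (p q : A) : ofPauli p q pauliZ = -Complex.I • (p * q) := by
  have h : Complex.I * (1 + 1) / 2 = Complex.I := by ring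
  simp [ofPauli_apply, pauliZ, h]

namespace Cl

open Algebra.TensorProduct

variable {m : ℕ}

/-- The generators of `𝒞(m)` become `ω_j ⊗ σ_z`, so as to anticommute with the two new ones,
`1 ⊗ σ_x` and `1 ⊗ σ_y`. -/
theorem isCliffordFamily_pauli (m : ℕ) : IsCliffordFamily
    (Fin.snoc (Fin.snoc (fun j => ω j ⊗ₜ pauliZ) (1 ⊗ₜ pauliX) : Fin (m + 1) → _) (1 ⊗ₜ pauliY) :
      Fin (m + 2) → Cl m ⊗[ℂ] Matrix (Fin 2) (Fin 2) ℂ) := by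
  have hω : IsCliffordFamily (fun j => ω j ⊗ₜ pauliZ :
      Fin m → Cl m ⊗[ℂ] Matrix (Fin 2) (Fin 2) ℂ) := by
    refine isCliffordFamily_of_sq_of_anticomm (fun j => ?_) fun j k hjk => ?_
    · rw [tmul_mul_tmul, isCliffordFamily_ω.sq, pauliZ_sq, one_def]
    · rw [tmul_mul_tmul, tmul_mul_tmul, isCliffordFamily_ω.anticomm hjk, TensorProduct.neg_tmul]
  refine (hω.snoc ?_ fun j => ?_).snoc ?_ fun j => ?_
  · rw [tmul_mul_tmul, pauliX_sq, one_mul, one_def]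
  · rw [tmul_mul_tmul, tmul_mul_tmul, one_mul, mul_one, pauliZ_mul_pauliX, TensorProduct.tmul_neg]
  · rw [tmul_mul_tmul, pauliY_sq, one_mul, one_def]
  · induction j using Fin.lastCases with
    | last =>
      rw [Fin.snoc_last, tmul_mul_tmul, tmul_mul_tmul, pauliX_mul_pauliY, TensorProduct.tmul_neg]
    | cast j =>
      rw [Fin.snoc_castSucc, tmul_mul_tmul, tmul_mul_tmul, one_mul, mul_one, pauliZ_mul_pauliY,
        TensorProduct.tmul_neg]

/-- The element of `𝒞(m+2)` that corresponds to `σ_z` when the last two generators correspond to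
`σ_x` and `σ_y`; it anticommutes with these two and commutes with the other generators. -/
noncomputable def lastZ (m : ℕ) : Cl (m + 2) :=
  -Complex.I • (ω (Fin.last m).castSucc * ω (Fin.last (m + 1)))

theorem ω_last_mul_ω_last :
    (ω (Fin.last (m + 1)) * ω (Fin.last m).castSucc : Cl (m + 2)) =
      -(ω (Fin.last m).castSucc * ω (Fin.last (m + 1))) :=
  isCliffordFamily_ω.anticomm (Fin.castSucc_lt_last _).ne'

theorem ω_mul_ω_last (j : Fin m) : (ω j.castSucc.castSucc * ω (Fin.last (m + 1)) : Cl (m + 2)) =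
      -(ω (Fin.last (m + 1)) * ω j.castSucc.castSucc) :=
  isCliffordFamily_ω.anticomm (Fin.castSucc_lt_last _).ne

theorem ω_mul_ω_castSucc_last (j : Fin m) :
    (ω j.castSucc.castSucc * ω (Fin.last m).castSucc : Cl (m + 2)) =
      -(ω (Fin.last m).castSucc * ω j.castSucc.castSucc) :=
  isCliffordFamily_ω.anticomm fun h => (Fin.castSucc_lt_last j).ne (Fin.castSucc_injective _ h)

theorem commute_ω_lastZ (j : Fin m) : Commute (ω j.castSucc.castSucc : Cl (m + 2)) (lastZ m) := by
  refine Commute.smul_right ?_ _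
  change _ = _
  rw [← mul_assoc, ω_mul_ω_castSucc_last, neg_mul, mul_assoc, ω_mul_ω_last, mul_neg, neg_neg,
    mul_assoc]

theorem lastZ_sq (m : ℕ) : lastZ m * lastZ m = 1 := by
  rw [lastZ, smul_mul_smul_comm, neg_mul_neg, Complex.I_mul_I, mul_assoc,
    ← mul_assoc (ω (Fin.last (m + 1))), ω_last_mul_ω_last,
    neg_mul, mul_neg, mul_assoc, isCliffordFamily_ω.sq, mul_one, isCliffordFamily_ω.sq]
  simp

theorem ω_last_mul_lastZ (m : ℕ) :
    ω (Fin.last (m + 1)) * lastZ m = -(lastZ m * ω (Fin.last (m + 1))) := by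
  rw [lastZ, mul_smul_comm, ← mul_assoc, ω_last_mul_ω_last, smul_mul_assoc, neg_mul, smul_neg]

theorem ω_castSucc_last_mul_lastZ (m : ℕ) :
    ω (Fin.last m).castSucc * lastZ m = -(lastZ m * ω (Fin.last m).castSucc) := by
  rw [lastZ, mul_smul_comm, smul_mul_assoc, mul_assoc _ _ (ω (Fin.last m).castSucc),
    ω_last_mul_ω_last, mul_neg, smul_neg, neg_neg]

/-- The factor `σ_z` makes the first `m` generators commute with the last two. -/
theorem isCliffordFamily_lastZ (m : ℕ) :
    IsCliffordFamily fun j : Fin m => (ω j.castSucc.castSucc * lastZ m : Cl (m + 2)) := by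
  refine isCliffordFamily_of_sq_of_anticomm (fun j => ?_) fun j k hjk => ?_
  · rw [(commute_ω_lastZ j).symm.mul_mul_mul_comm, lastZ_sq, mul_one, isCliffordFamily_ω.sq]
  · rw [(commute_ω_lastZ k).symm.mul_mul_mul_comm, (commute_ω_lastZ j).symm.mul_mul_mul_comm,
      isCliffordFamily_ω.castSucc.castSucc.anticomm hjk, neg_mul]

/-- The morphism from `𝒞(m) ⊗ M₂(ℂ)` to `𝒞(m+2)`. -/
noncomputable def ofTensorMatrix (m : ℕ) :
    (Cl m ⊗[ℂ] Matrix (Fin 2) (Fin 2) ℂ) →ₐ[ℂ] Cl (m + 2) :=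
  Algebra.TensorProduct.lift (lift (isCliffordFamily_lastZ m))
    (pauliLift (isCliffordFamily_ω.sq _) (isCliffordFamily_ω.sq _) ω_last_mul_ω_last) (by
      refine fun a M => commute_of_adjoin_eq_top (adjoin_eq_top m) (Algebra.adjoin_univ ℂ _) _ _
        ?_ a M
      rintro _ ⟨j, rfl⟩ N -
      have hP : Commute (ω j.castSucc.castSucc * lastZ m) (ω (Fin.last m).castSucc) := by
        change _ = _
        rw [mul_assoc, ← neg_eq_iff_eq_neg.2 (ω_castSucc_last_mul_lastZ m), mul_neg, ← mul_assoc,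
          ω_mul_ω_castSucc_last, neg_mul, neg_neg, mul_assoc]
      have hQ : Commute (ω j.castSucc.castSucc * lastZ m) (ω (Fin.last (m + 1))) := by
        change _ = _
        rw [mul_assoc, ← neg_eq_iff_eq_neg.2 (ω_last_mul_lastZ m), mul_neg, ← mul_assoc,
          ω_mul_ω_last, neg_mul, neg_neg, mul_assoc]
      rw [lift_ω, pauliLift_apply, ofPauli_apply]
      exact ((((Commute.one_right _).smul_right _).add_right (hP.smul_right _)).add_right
        (hQ.smul_right _)).sub_right ((hP.mul_right hQ).smul_right _))

/-- The periodicity isomorphism of complex Clifford algebras. -/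
noncomputable def tensorMatrixEquiv (m : ℕ) :
    Cl (m + 2) ≃ₐ[ℂ] Cl m ⊗[ℂ] Matrix (Fin 2) (Fin 2) ℂ :=
  AlgEquiv.ofAlgHom (lift (isCliffordFamily_pauli m)) (ofTensorMatrix m)
    (by
      have hX : lift (isCliffordFamily_pauli m) (ω (Fin.last m).castSucc) = 1 ⊗ₜ pauliX := by simp
      have hY : lift (isCliffordFamily_pauli m) (ω (Fin.last (m + 1))) = 1 ⊗ₜ pauliY := by simp
      refine Algebra.TensorProduct.ext (algHom_ext fun j => ?_) (AlgHom.ext fun M => ?_)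
      · change lift (isCliffordFamily_pauli m) (ofTensorMatrix m (ω j ⊗ₜ 1)) = ω j ⊗ₜ 1
        rw [ofTensorMatrix, lift_tmul, map_one, mul_one, lift_ω, map_mul, lift_ω, lastZ, map_smul,
          map_mul, hX, hY, Fin.snoc_castSucc, Fin.snoc_castSucc, tmul_mul_tmul, one_mul,
          ← TensorProduct.tmul_smul, ← pauliZ_eq, tmul_mul_tmul, pauliZ_sq, mul_one]
      · change lift (isCliffordFamily_pauli m) (ofTensorMatrix m (1 ⊗ₜ M)) =
          includeRight (R := ℂ) (A := Cl m) M
        rw [ofTensorMatrix, lift_tmul, map_one, one_mul, pauliLift_apply, map_ofPauli, hX, hY]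
        conv_rhs => rw [← ofPauli_pauli M, map_ofPauli]
        rfl)
    (by
      refine algHom_ext fun j => ?_
      rw [AlgHom.comp_apply, lift_ω, ofTensorMatrix, AlgHom.id_apply]
      induction j using Fin.lastCases with
      | last =>
        rw [Fin.snoc_last, lift_tmul, map_one, one_mul, pauliLift_apply, ofPauli_pauliY]
      | cast j =>
        rw [Fin.snoc_castSucc]
        induction j using Fin.lastCases with
        | last =>
          rw [Fin.snoc_last, lift_tmul, map_one, one_mul, pauliLift_apply, ofPauli_pauliX]
        | cast j =>
          rw [Fin.snoc_castSucc, lift_tmul, lift_ω, pauliLift_apply, ofPauli_pauliZ, ← lastZ,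
            mul_assoc, lastZ_sq, mul_one])

/-- `𝒞(0)` is the field of scalars. -/
noncomputable def zeroEquiv : Cl 0 ≃ₐ[ℂ] ℂ :=
  AlgEquiv.ofAlgHom (lift (g := (Fin.elim0 : Fin 0 → ℂ)) fun j => j.elim0) (Algebra.ofId ℂ (Cl 0))
    (by ext) (algHom_ext fun j => j.elim0)

theorem nonempty_algEquiv_matrix (n : ℕ) :
    Nonempty (Cl (2 * n) ≃ₐ[ℂ] Matrix (Fin (2 ^ n)) (Fin (2 ^ n)) ℂ) := by
  induction n with
  | zero =>
    refine ⟨zeroEquiv.trans (AlgEquiv.ofBijective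
      (Algebra.ofId ℂ (Matrix (Fin 1) (Fin 1) ℂ)) ⟨RingHom.injective _, fun M => ⟨M 0 0, ?_⟩⟩)⟩
    ext (i : Fin 1) (j : Fin 1)
    rw [Subsingleton.elim i 0, Subsingleton.elim j 0]
    simp [Algebra.ofId_apply, Matrix.algebraMap_matrix_apply]
  | succ n ih =>
    obtain ⟨φ⟩ := ih
    exact ⟨(tensorMatrixEquiv (2 * n)).trans <| (congr φ AlgEquiv.refl).trans <|
      (Matrix.kroneckerAlgEquiv (Fin (2 ^ n)) (Fin 2) ℂ).trans <|
      Matrix.reindexAlgEquiv ℂ ℂ (finProdFinEquiv.trans (finCongr (pow_succ 2 n).symm))⟩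

end Cl

end Matrix

theorem proposition7p4 (n : ℕ) :
    (∃ φ : AΛ n ≃ₐ[ℂ] (Cl.grading (2 * n + 1) ᵍ⊗[ℂ] UOsp.grading),
      (∀ j : Fin (2 * n + 1), φ (AΛ.gen (AGen.ω j)) = Cl.ω j ᵍ⊗ₜ[ℂ] (1 : UOsp)) ∧
      φ (AΛ.gen AGen.Ep) = (1 : Cl (2 * n + 1)) ᵍ⊗ₜ[ℂ] UOsp.Ep ∧
      φ (AΛ.gen AGen.Em) = (1 : Cl (2 * n + 1)) ᵍ⊗ₜ[ℂ] UOsp.Em ∧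
      φ (AΛ.gen AGen.Lam) =
        (Complex.I ^ n • Cl.volume (2 * n + 1)) ᵍ⊗ₜ[ℂ] UOsp.ghost ∧
      ((Complex.I ^ n • Cl.volume (2 * n + 1)) ᵍ⊗ₜ[ℂ] UOsp.ghost :
          Cl.grading (2 * n + 1) ᵍ⊗[ℂ] UOsp.grading) ∈
        Subalgebra.center ℂ (Cl.grading (2 * n + 1) ᵍ⊗[ℂ] UOsp.grading)) ∧
    Nonempty (AΛ n ≃ₐ[ℂ] (Cl (2 * n) ⊗[ℂ] UOsp.Smash)) ∧
    Nonempty ((Cl (2 * n) ⊗[ℂ] UOsp.Smash) ≃ₐ[ℂ]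
      Matrix (Fin (2 ^ n)) (Fin (2 ^ n)) UOsp.Smash) := by
  refine ⟨⟨AΛ.gradedTensorEquiv n, fun j => AΛ.gradedTensorEquiv_gen n _,
    AΛ.gradedTensorEquiv_gen n _, AΛ.gradedTensorEquiv_gen n _, AΛ.gradedTensorEquiv_Lam n, ?_⟩,
    ⟨AΛ.tensorEquiv n⟩, ?_⟩
  · rw [← AΛ.gradedTensorEquiv_Lam, Subalgebra.mem_center_iff]
    intro b
    obtain ⟨a, rfl⟩ := (AΛ.gradedTensorEquiv n).surjective b
    rw [← map_mul, ← map_mul, Subalgebra.mem_center_iff.1 AΛ.Lam_mem_center a]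
  · obtain ⟨φ⟩ := Cl.nonempty_algEquiv_matrix n
    exact ⟨(Algebra.TensorProduct.congr φ AlgEquiv.refl).trans <|
      (Algebra.TensorProduct.comm ℂ _ _).trans
        (matrixEquivTensor (Fin (2 ^ n)) ℂ UOsp.Smash).symm⟩
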